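/- **Theorem (First-order finite-sample expected generalization error).** Let $H\in\mathbb{R}^{m\times n}$ with $\operatorname{rank}(H)=n-1$, let $T_o>n$, and let $\mathbf n\in\mathbb{R}^m$ be a unit vector with $H^T\mathbf n=0$. Let $x\sim\mathcal N(0,I_n)$ and $\varepsilon\sim\mathcal N(0,\sigma^2 I_m)$ be independent and $z=Hx+\varepsilon$. The training set consists of $T_o$ independent samples, arranged as columns: $\bar Z=HX\in\mathbb{R}^{m\times T_o}$ are the noise-free measurements, $E\in\mathbb{R}^{m\times T_o}$ is the noise, and $Z=\bar Z+E$. Write $A^+$ for the Moore–Penrose pseudoinverse, and put $$\delta=-(\bar Z^T)^+E^T\mathbf n,\qquad \hat{\mathbf n}=\mathbf n+\delta .$$ Let $$E_{\mathrm{gen}}=\mathbb E_Z\big[\mathbb E_z[\,|z^T\hat{\mathbf n}|^2\,]\big],$$ where $z$ is a fresh sample independent of the training set and $\mathbb E_Z$ denotes the expectation over the training set. Then $|z^T\hat{\mathbf n}|^2$ is integrable. If $Z_\star\in\mathbb{R}^{m\times T_\star}$ is the matrix of the first $T_\star$ terms of an infinite sequence of independent test samples that is independent of the training set, then almost surely with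 respect to the test sequence $\mathbb E_Z[\|Z_\star^T\hat{\mathbf n}\|^2]$ is finite for all $T_\star$ and $$E_{\mathrm{gen}}=\lim_{T_\star\to\infty}\frac{\mathbb E_Z\big[\|Z_\star^T\hat{\mathbf n}\|^2\big]}{T_\star}.$$ Moreover $$E_{\mathrm{gen}}=\sigma^2\Big(1+\frac{\operatorname{rank}(H)}{T_o-n}\Big)+\mathcal O(\sigma^4)\qquad(\sigma\to0),$$ and, for every $\sigma$, the remainder is at most $\sigma^4\,\|H^+\|_F^2/(T_o-n)$ in absolute value, where $\|\cdot\|_F$ is the Frobenius norm. -/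

import Mathlib

open MeasureTheory ProbabilityTheory Matrix Filter Topology Asymptotics

/-- `B` is a Moore–Penrose inverse of the real matrix `A`: the four Penrose conditions. -/
structure IsMoorePenrose {k l : ℕ} (A : Matrix (Fin k) (Fin l) ℝ)
    (B : Matrix (Fin l) (Fin k) ℝ) : Prop where
  mul_mul_left : A * B * A = A
  mul_mul_right : B * A * B = B
  symm_left : (A * B)ᵀ = A * B
  symm_right : (B * A)ᵀ = B * A

theorem exists_isMoorePenrose {k l : ℕ} (A : Matrix (Fin k) (Fin l) ℝ) :
    ∃ B, IsMoorePenrose A B := by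
  have hS : (Aᵀ * A).IsHermitian := by
    simpa using isHermitian_conjTranspose_mul_self A
  -- a symmetric generalized inverse `P` of the Gram matrix, from the spectral theorem
  obtain ⟨P, hPs, hSPS, hPSP, hPS⟩ : ∃ P : Matrix (Fin l) (Fin l) ℝ, Pᵀ = P ∧
      (Aᵀ * A) * P * (Aᵀ * A) = Aᵀ * A ∧ P * (Aᵀ * A) * P = P ∧
      (P * (Aᵀ * A))ᵀ = P * (Aᵀ * A) := by
    have hsp := hS.spectral_theorem
    set U : Matrix (Fin l) (Fin l) ℝ := (hS.eigenvectorUnitary).1 with hU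
    set d := hS.eigenvalues with hd
    have hUU : Uᵀ * U = 1 := by
      have := Unitary.coe_star_mul_self hS.eigenvectorUnitary
      simpa [star_eq_conjTranspose] using this
    have hS' : Aᵀ * A = U * diagonal d * Uᵀ := by
      rw [hsp]
      simp [Unitary.conjStarAlgAut_apply, star_eq_conjTranspose, hU, hd]
    have key : ∀ a b : Fin l → ℝ, (U * diagonal a * Uᵀ) * (U * diagonal b * Uᵀ)
        = U * diagonal (fun i => a i * b i) * Uᵀ := by
      intro a b
      calc _ = U * diagonal a * (Uᵀ * U) * diagonal b * Uᵀ := by simp only [Matrix.mul_assoc]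
        _ = _ := by rw [hUU, Matrix.mul_one, Matrix.mul_assoc U, diagonal_mul_diagonal]
    have hT : ∀ a : Fin l → ℝ, (U * diagonal a * Uᵀ)ᵀ = U * diagonal a * Uᵀ := by
      intro a; simp [Matrix.transpose_mul, Matrix.mul_assoc]
    refine ⟨U * diagonal (fun i => (d i)⁻¹) * Uᵀ, hT _, ?_, ?_, ?_⟩
    · rw [hS', key, key]; simp [mul_inv_mul_cancel]
    · rw [hS', key, key]
      congr 3; funext i
      by_cases h : d i = 0 <;> simp [h]
    · rw [hS', key, hT]
  refine ⟨P * Aᵀ, ?_, ?_, ?_, ?_⟩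
  · rw [← sub_eq_zero, ← conjTranspose_mul_self_eq_zero]
    have : A * (P * Aᵀ) * A - A = A * (P * (Aᵀ * A) - 1) := by
      simp [Matrix.mul_sub, Matrix.mul_assoc]
    rw [this, conjTranspose_eq_transpose_of_trivial, Matrix.transpose_mul, ← Matrix.mul_assoc,
      Matrix.mul_assoc _ Aᵀ A, Matrix.mul_assoc _ (Aᵀ * A)]
    have h0 : (Aᵀ * A) * (P * (Aᵀ * A) - 1) = 0 := by
      rw [Matrix.mul_sub, ← Matrix.mul_assoc, hSPS, Matrix.mul_one, sub_self]
    rw [h0, Matrix.mul_zero]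
  · rw [Matrix.mul_assoc P, ← Matrix.mul_assoc _ P, hPSP]
  · simp [Matrix.transpose_mul, hPs, Matrix.mul_assoc]
  · rw [Matrix.mul_assoc, hPS]

theorem IsMoorePenrose.unique {k l : ℕ} {A : Matrix (Fin k) (Fin l) ℝ}
    {B C : Matrix (Fin l) (Fin k) ℝ} (hB : IsMoorePenrose A B) (hC : IsMoorePenrose A C) :
    B = C := by
  have h1 : A * B = A * C := by
    calc A * B = (A * C * A * B)ᵀ := by rw [hC.mul_mul_left, hB.symm_left]
      _ = (A * B)ᵀ * (A * C)ᵀ := by rw [← Matrix.transpose_mul, Matrix.mul_assoc (A * C)]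
      _ = A * B * A * C := by rw [hB.symm_left, hC.symm_left, ← Matrix.mul_assoc]
      _ = A * C := by rw [hB.mul_mul_left]
  have h2 : B * A = C * A := by
    calc B * A = (B * A * (C * A))ᵀ := by
          rw [Matrix.mul_assoc, ← Matrix.mul_assoc A, hC.mul_mul_left, hB.symm_right]
      _ = (C * A)ᵀ * (B * A)ᵀ := Matrix.transpose_mul _ _
      _ = C * (A * B * A) := by rw [hB.symm_right, hC.symm_right]; simp only [Matrix.mul_assoc]
      _ = C * A := by rw [hB.mul_mul_left]
  calc B = B * A * B := hB.mul_mul_right.symm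
    _ = C * (A * B) := by rw [h2, Matrix.mul_assoc]
    _ = C * A * C := by rw [h1, Matrix.mul_assoc]
    _ = C := hC.mul_mul_right

noncomputable section

/-- The Moore–Penrose pseudoinverse `A⁺`. -/
def pinv {k l : ℕ} (A : Matrix (Fin k) (Fin l) ℝ) : Matrix (Fin l) (Fin k) ℝ :=
  Classical.choose (exists_isMoorePenrose A)

theorem pinv_spec {k l : ℕ} (A : Matrix (Fin k) (Fin l) ℝ) : IsMoorePenrose A (pinv A) :=
  Classical.choose_spec (exists_isMoorePenrose A)

/-- The squared Frobenius norm. -/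
def frobSq {k l : ℕ} (A : Matrix (Fin k) (Fin l) ℝ) : ℝ := ∑ i, ∑ j, A i j ^ 2

/-- One sample of the DC model: a pair (state `x`, noise `ε`). -/
abbrev DCSample (m n : ℕ) := (Fin n → ℝ) × (Fin m → ℝ)

/-- The law `N(0, I_n) ⊗ N(0, σ² I_m)` of one pair (state, noise). -/
def sampleLaw (m n : ℕ) (σ : ℝ) : Measure (DCSample m n) :=
  (Measure.pi fun _ : Fin n => gaussianReal 0 1).prod
    (Measure.pi fun _ : Fin m => gaussianReal 0 (σ ^ 2).toNNReal)

/-- The law of a training set: `T` independent samples. -/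
def trainLaw (m n T : ℕ) (σ : ℝ) : Measure (Fin T → DCSample m n) :=
  Measure.pi fun _ => sampleLaw m n σ

instance (m n : ℕ) (σ : ℝ) : IsProbabilityMeasure (sampleLaw m n σ) := by
  unfold sampleLaw; infer_instance

/-- The law of an infinite sequence of independent test samples; the first `N` of them
form a test set of size `N`. -/
def testLaw (m n : ℕ) (σ : ℝ) : Measure (ℕ → DCSample m n) :=
  Measure.infinitePi fun _ => sampleLaw m n σ

/-- The state matrix `X`, whose columns are the states of the samples. -/
def stateMatrix {m n T : ℕ} (s : Fin T → DCSample m n) : Matrix (Fin n) (Fin T) ℝ :=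
  Matrix.of fun i t => (s t).1 i

/-- The noise matrix `E`, whose columns are the noise vectors of the samples. -/
def noiseMatrix {m n T : ℕ} (s : Fin T → DCSample m n) : Matrix (Fin m) (Fin T) ℝ :=
  Matrix.of fun i t => (s t).2 i

/-- The noise-free measurements `Z̄ = H X`. -/
def cleanMatrix {m n T : ℕ} (H : Matrix (Fin m) (Fin n) ℝ) (s : Fin T → DCSample m n) :
    Matrix (Fin m) (Fin T) ℝ :=
  H * stateMatrix s

/-- The noisy measurements `Z = H X + E`. -/
def measMatrix {m n T : ℕ} (H : Matrix (Fin m) (Fin n) ℝ) (s : Fin T → DCSample m n) :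
    Matrix (Fin m) (Fin T) ℝ :=
  cleanMatrix H s + noiseMatrix s

/-- One noisy measurement `z = H x + ε`. -/
def meas {m n : ℕ} (H : Matrix (Fin m) (Fin n) ℝ) (w : DCSample m n) : Fin m → ℝ :=
  H *ᵥ w.1 + w.2

/-- The first-order estimation error `δ = -(Z̄ᵀ)⁺ Eᵀ ν` of the null vector `ν`. -/
def firstOrderError {m n T : ℕ} (H : Matrix (Fin m) (Fin n) ℝ) (ν : Fin m → ℝ)
    (s : Fin T → DCSample m n) : Fin m → ℝ :=
  -(pinv (cleanMatrix H s)ᵀ *ᵥ ((noiseMatrix s)ᵀ *ᵥ ν))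

/-- The first-order estimator `ν̂ = ν + δ`. -/
def nullEstimator {m n T : ℕ} (H : Matrix (Fin m) (Fin n) ℝ) (ν : Fin m → ℝ)
    (s : Fin T → DCSample m n) : Fin m → ℝ :=
  ν + firstOrderError H ν s

/-- The residual `|zᵀ ν̂|²` of the estimator trained on `s` at the test sample `w`. -/
def testResidual {m n T : ℕ} (H : Matrix (Fin m) (Fin n) ℝ) (ν : Fin m → ℝ)
    (s : Fin T → DCSample m n) (w : DCSample m n) : ℝ :=
  (meas H w ⬝ᵥ nullEstimator H ν s) ^ 2

/-- The total residual `‖Z⋆ᵀ ν̂‖²` (Euclidean norm) of the estimator trained on `s` over the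
test set formed by the first `N` terms of `w`. -/
def testSetResidual {m n T : ℕ} (H : Matrix (Fin m) (Fin n) ℝ) (ν : Fin m → ℝ)
    (s : Fin T → DCSample m n) (w : ℕ → DCSample m n) (N : ℕ) : ℝ :=
  let r := (measMatrix H fun t : Fin N => w t)ᵀ *ᵥ nullEstimator H ν s
  r ⬝ᵥ r

/-- The expected generalization error `E_Z [ E_z |zᵀ ν̂|² ]`. -/
def genError {m n : ℕ} (H : Matrix (Fin m) (Fin n) ℝ) (ν : Fin m → ℝ) (T : ℕ) (σ : ℝ) : ℝ :=
  ∫ s, (∫ w, testResidual H ν s w ∂sampleLaw m n σ) ∂trainLaw m n T σ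

end

/-! Write `r` for the rank of `H`, `B = (Z̄ᵀ)⁺` and `δ = -B Eᵀν`. Averaging over a fresh sample
gives `|Hᵀν̂|² + σ²|ν̂|²`. Since `Hᵀν = 0` and the range of `B` lies in that of `H`, `ν` is
orthogonal to `δ`, so this equals `|Hᵀδ|² + σ²(1 + |δ|²)`. The vector `Eᵀν` has independent centred
entries of variance `σ²` and is independent of `B`; hence the means of `|Hᵀδ|²` and `|δ|²` are `σ²`
times those of `‖HᵀB‖_F²` and `‖B‖_F²`.

Factor `H = G W` with `W Wᵀ = 1` and `GᵀG = diagonal d`. Then `Y = W X` is an `r × T` standard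
Gaussian matrix, and with `L = (Y Yᵀ)⁻¹` almost surely `B = G (diagonal d)⁻¹ L Y`. The two Frobenius
norms become `∑ L i i` and `∑ (d i)⁻¹ L i i`. The inverse Wishart mean `E[L i i] = 1/(T - r - 1)`
(`integral_inv_mul_transpose_apply_self`) and `‖H⁺‖_F² = ∑ (d i)⁻¹` give an exact formula for the
error (`genError_eq`), whose `σ⁴` term is the whole remainder.

The limit over test sets is the strong law of large numbers for the residual averaged over training.
-/

/-! ### Gaussian product measures: invariance, transposition, resampling -/

/-- The standard Gaussian measure on `ι → ℝ`. -/
noncomputable abbrev gaussianPi (ι : Type*) [Fintype ι] : Measure (ι → ℝ) :=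
  Measure.pi fun _ => gaussianReal 0 1

/-- The characteristic function of the image at `t` is that of the source at `Wᵀ t`, which depends
only on `|Wᵀ t|² = |t|²`. -/
theorem gaussianPi_map_mulVec {ι κ : Type*} [Fintype ι] [Fintype κ] [DecidableEq ι]
    (W : Matrix ι κ ℝ) (hW : W * Wᵀ = 1) :
    (gaussianPi κ).map (W *ᵥ ·) = gaussianPi ι := by
  have hm : Measurable (fun x : κ → ℝ => W *ᵥ x) :=
    (Continuous.matrix_mulVec continuous_const continuous_id).measurable
  have : IsProbabilityMeasure ((gaussianPi κ).map (W *ᵥ ·)) :=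
    Measure.isProbabilityMeasure_map hm.aemeasurable
  refine charFun_eq_pi_iff.1 fun t => ?_
  have h1 := charFun_pi (μ := fun _ : κ => gaussianReal 0 1) (WithLp.toLp 2 (Wᵀ *ᵥ t.ofLp))
  have h2 : charFun (((gaussianPi κ).map (W *ᵥ ·)).map (WithLp.toLp 2)) t
      = charFun ((gaussianPi κ).map (WithLp.toLp 2)) (WithLp.toLp 2 (Wᵀ *ᵥ t.ofLp)) := by
    rw [charFun_apply, charFun_apply, ← MeasurableEquiv.coe_toLp, ← MeasurableEquiv.coe_toLp,
      integral_map_equiv, integral_map_equiv, integral_map hm.aemeasurable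
        (by fun_prop)]
    refine integral_congr_ae (ae_of_all _ fun x => ?_)
    have : inner ℝ (WithLp.toLp 2 (W *ᵥ x)) t
        = inner ℝ (WithLp.toLp 2 x) (WithLp.toLp 2 (Wᵀ *ᵥ t.ofLp)) := by
      rw [EuclideanSpace.inner_eq_star_dotProduct, EuclideanSpace.inner_eq_star_dotProduct]
      simp only [star_trivial]
      rw [dotProduct_mulVec, Matrix.mulVec_transpose]
    simp only [MeasurableEquiv.coe_toLp]
    rw [this]
  rw [h2, h1]
  simp_rw [charFun_gaussianReal, ← Complex.exp_sum]
  congr 1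
  simp only [Complex.ofReal_zero, mul_zero, zero_mul, zero_sub, NNReal.coe_one,
    Complex.ofReal_one, one_mul, Finset.sum_neg_distrib, neg_inj]
  rw [← Finset.sum_div, ← Finset.sum_div]
  congr 1
  have : (Wᵀ *ᵥ t.ofLp) ⬝ᵥ (Wᵀ *ᵥ t.ofLp) = t.ofLp ⬝ᵥ t.ofLp := by
    rw [dotProduct_mulVec, Matrix.vecMul_transpose, Matrix.mulVec_mulVec, hW, Matrix.one_mulVec]
  simp only [dotProduct] at this
  have h3 := congrArg (fun r : ℝ => (r : ℂ)) this
  push_cast at h3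
  simpa [sq] using h3

/-- Both iterated products are curryings of one product over pairs. This lets a matrix with
independent columns be read as one with independent rows. -/
theorem pi_pi_map_swap {ι κ X : Type*} [Fintype ι] [Fintype κ] [MeasurableSpace X]
    (μ : Measure X) [IsProbabilityMeasure μ] :
    (Measure.pi fun _ : κ => Measure.pi fun _ : ι => μ).map
      (fun (x : κ → ι → X) (i : ι) (k : κ) => x k i) =
    Measure.pi fun _ : ι => Measure.pi fun _ : κ => μ := by
  have h1 := Measure.infinitePi_map_curry_symm (fun (_ : κ) (_ : ι) => μ)
  have h2 := Measure.infinitePi_map_curry (fun (_ : ι) (_ : κ) => μ)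
  have h3 := Measure.infinitePi_map_piCongrLeft (fun _ : ι × κ => μ) (Equiv.prodComm κ ι)
  simp only [Measure.infinitePi_eq_pi] at h1 h2 h3
  rw [← h2, ← h3, ← h1, Measure.map_map (by fun_prop) (by fun_prop),
    Measure.map_map (by fun_prop) (by fun_prop)]
  congr 1

/-- Resampling one coordinate does not change the law. With Fubini this isolates one row of a
Gaussian matrix while the others stay fixed. -/
theorem measurePreserving_update {ι : Type*} [Fintype ι] [DecidableEq ι] {X : ι → Type*}
    [∀ i, MeasurableSpace (X i)] (μ : ∀ i, Measure (X i)) [∀ i, IsProbabilityMeasure (μ i)]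
    (i : ι) :
    MeasurePreserving (fun p : (∀ j, X j) × X i => Function.update p.1 i p.2)
      ((Measure.pi μ).prod (μ i)) (Measure.pi μ) := by
  have hm : Measurable (fun p : (∀ j, X j) × X i => Function.update p.1 i p.2) := by
    refine measurable_pi_lambda _ fun j => ?_
    by_cases h : j = i
    · subst h; simpa using measurable_snd
    · simp only [Function.update_of_ne h]
      exact (measurable_pi_apply j).comp measurable_fst
  refine ⟨hm, (Measure.pi_eq fun s hs => ?_).symm⟩
  rw [Measure.map_apply hm (MeasurableSet.univ_pi hs)]
  -- The old value at `i` is overwritten, so it is unconstrained and contributes a factor of mass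
  -- one.
  have : (fun p : (∀ j, X j) × X i => Function.update p.1 i p.2) ⁻¹' (Set.univ.pi s)
      = (Set.univ.pi (Function.update s i Set.univ)) ×ˢ s i := by
    ext p
    simp only [Set.mem_preimage, Set.mem_pi, Set.mem_univ, true_imp_iff, Set.mem_prod]
    constructor
    · intro h
      refine ⟨fun j => ?_, by simpa using h i⟩
      by_cases hj : j = i
      · subst hj; simp
      · simpa [Function.update_of_ne hj] using h j
    · rintro ⟨h, h'⟩ j
      by_cases hj : j = i
      · subst hj; simpa
      · simpa [Function.update_of_ne hj] using h j
  rw [this, Measure.prod_prod, Measure.pi_pi, ← Finset.prod_erase_mul _ _ (Finset.mem_univ i),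
    ← Finset.prod_erase_mul Finset.univ (fun j => μ j (s j)) (Finset.mem_univ i)]
  simp only [Function.update_self, measure_univ, mul_one]
  congr 1
  refine Finset.prod_congr rfl fun j hj => ?_
  rw [Function.update_of_ne (Finset.ne_of_mem_erase hj)]

/-! ### Mean inverse squared norm of a Gaussian vector -/

theorem integral_exp_neg_mul_sq_gaussianReal {t : ℝ} (ht : 0 ≤ t) :
    ∫ x, Real.exp (-t * x ^ 2) ∂gaussianReal 0 1 = (1 + 2 * t) ^ (-(1 / 2) : ℝ) := by
  rw [integral_gaussianReal_eq_integral_smul one_ne_zero]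
  have h : ∀ x : ℝ, gaussianPDFReal 0 1 x • Real.exp (-t * x ^ 2)
      = (√(2 * Real.pi))⁻¹ * Real.exp (-(1 / 2 + t) * x ^ 2) := by
    intro x
    simp only [gaussianPDFReal, NNReal.coe_one, mul_one, sub_zero, smul_eq_mul]
    rw [mul_assoc, ← Real.exp_add]
    congr 2
    ring
  simp_rw [h]
  rw [integral_const_mul, integral_gaussian, ← Real.sqrt_inv, ← Real.sqrt_mul (by positivity),
    Real.rpow_neg (by positivity), ← Real.sqrt_eq_rpow, ← Real.sqrt_inv]
  congr 1
  have : 1 + 2 * t ≠ 0 := by positivity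
  have h2 : 1 / 2 + t ≠ 0 := by positivity
  field_simp

theorem integral_exp_neg_mul_dotProduct_gaussianPi {κ : Type*} [Fintype κ] {t : ℝ} (ht : 0 ≤ t) :
    ∫ x, Real.exp (-t * (x ⬝ᵥ x)) ∂gaussianPi κ = (1 + 2 * t) ^ (-(Fintype.card κ / 2) : ℝ) := by
  have h : ∀ x : κ → ℝ, Real.exp (-t * (x ⬝ᵥ x)) = ∏ i, Real.exp (-t * x i ^ 2) := by
    intro x
    rw [← Real.exp_sum, dotProduct, Finset.mul_sum]
    simp [sq]
  simp_rw [h]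
  rw [integral_fintype_prod_eq_pow (fun x : ℝ => Real.exp (-t * x ^ 2)),
    integral_exp_neg_mul_sq_gaussianReal ht, ← Real.rpow_natCast, ← Real.rpow_mul (by positivity)]
  congr 1
  ring

/-- The antiderivative has exponent `1 - k/2`, which is negative exactly because `2 < k`, so it
vanishes at infinity. -/
theorem integral_Ioi_one_add_two_mul_rpow {k : ℝ} (hk : 2 < k) :
    IntegrableOn (fun t : ℝ => (1 + 2 * t) ^ (-(k / 2))) (Set.Ioi 0) ∧
    ∫ t in Set.Ioi (0 : ℝ), (1 + 2 * t) ^ (-(k / 2)) = 1 / (k - 2) := by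
  have hk' : k - 2 ≠ 0 := by linarith
  have hd : ∀ t ∈ Set.Ici (0 : ℝ), HasDerivAt
      (fun t : ℝ => -(1 / (k - 2)) * (1 + 2 * t) ^ (-(k / 2) + 1)) ((1 + 2 * t) ^ (-(k / 2))) t := by
    intro t ht
    have ht' : (0 : ℝ) ≤ t := ht
    have h1 : HasDerivAt (fun t : ℝ => 1 + 2 * t) 2 t := by
      simpa using ((hasDerivAt_id t).const_mul (2 : ℝ)).const_add 1
    have h2 := (h1.rpow_const (p := -(k / 2) + 1) (Or.inl (by positivity))).const_mul
      (-(1 / (k - 2)))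
    refine h2.congr_deriv ?_
    rw [add_sub_cancel_right]
    field_simp
    ring
  have hlim : Tendsto (fun t : ℝ => -(1 / (k - 2)) * (1 + 2 * t) ^ (-(k / 2) + 1)) atTop (𝓝 0) := by
    have h1 : Tendsto (fun t : ℝ => 1 + 2 * t) atTop atTop :=
      tendsto_atTop_add_const_left _ _ (tendsto_id.const_mul_atTop (by norm_num))
    have h2 := ((tendsto_rpow_neg_atTop (y := k / 2 - 1) (by linarith)).comp h1).const_mul
      (-(1 / (k - 2)))
    rw [mul_zero] at h2
    refine h2.congr fun t => ?_
    simp only [Function.comp_apply]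
    congr 2
    ring
  have hpos : ∀ t ∈ Set.Ioi (0 : ℝ), 0 ≤ (1 + 2 * t) ^ (-(k / 2)) := by
    intro t ht
    have ht' : (0 : ℝ) < t := ht
    positivity
  refine ⟨integrableOn_Ioi_deriv_of_nonneg' hd hpos hlim, ?_⟩
  rw [integral_Ioi_of_hasDerivAt_of_nonneg' hd hpos hlim]
  simp

theorem lintegral_Ioi_exp_neg_mul {q : ℝ} (hq : 0 < q) :
    ∫⁻ t in Set.Ioi (0 : ℝ), ENNReal.ofReal (Real.exp (-t * q)) = ENNReal.ofReal q⁻¹ := by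
  have h := integral_exp_mul_Ioi (a := -q) (by linarith) 0
  rw [← ofReal_integral_eq_lintegral_ofReal]
  · congr 1
    rw [show (fun t : ℝ => Real.exp (-t * q)) = fun t => Real.exp (-q * t) by
      funext t; congr 1; ring, h]
    simp [neg_div_neg_eq]
  · have := exp_neg_integrableOn_Ioi 0 hq
    refine this.congr (ae_of_all _ fun t => ?_)
    simp only
    congr 1; ring
  · exact ae_of_all _ fun t => (Real.exp_pos _).le

/-- Write `1/q` as the integral of `exp (-t q)` over `t > 0` and exchange integrals by Tonelli: the
inner Gaussian integral factors over coordinates. Working with `∫⁻` makes finiteness a consequence.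
-/
theorem lintegral_inv_dotProduct_gaussianPi {κ : Type*} [Fintype κ]
    (hκ : 2 < Fintype.card κ) :
    ∫⁻ x, ENNReal.ofReal (x ⬝ᵥ x)⁻¹ ∂gaussianPi κ
      = ENNReal.ofReal (1 / ((Fintype.card κ : ℝ) - 2)) := by
  have hne : Nonempty κ := Fintype.card_pos_iff.1 (by omega)
  have hna : NullSingletonClass (gaussianReal 0 1) := nullSingletonClass_gaussianReal one_ne_zero
  have hae : ∀ᵐ x ∂gaussianPi κ, x ≠ 0 := by
    rw [ae_iff]
    simp
  have hk : (2 : ℝ) < Fintype.card κ := by exact_mod_cast hκ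
  calc ∫⁻ x, ENNReal.ofReal (x ⬝ᵥ x)⁻¹ ∂gaussianPi κ
      = ∫⁻ x, (∫⁻ t in Set.Ioi (0 : ℝ), ENNReal.ofReal (Real.exp (-t * (x ⬝ᵥ x))))
          ∂gaussianPi κ := by
        refine lintegral_congr_ae (hae.mono fun x hx => ?_)
        refine (lintegral_Ioi_exp_neg_mul ?_).symm
        simpa using (dotProduct_star_self_pos_iff (v := x)).2 hx
    _ = ∫⁻ t in Set.Ioi (0 : ℝ), ∫⁻ x, ENNReal.ofReal (Real.exp (-t * (x ⬝ᵥ x)))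
          ∂gaussianPi κ := by
        refine lintegral_lintegral_swap (Measurable.aemeasurable ?_)
        simp only [dotProduct, Function.uncurry_def]
        fun_prop
    _ = ∫⁻ t in Set.Ioi (0 : ℝ), ENNReal.ofReal ((1 + 2 * t) ^ (-(Fintype.card κ / 2) : ℝ)) := by
        refine setLIntegral_congr_fun measurableSet_Ioi fun t ht => ?_
        have ht' : (0 : ℝ) ≤ t := le_of_lt ht
        rw [← integral_exp_neg_mul_dotProduct_gaussianPi ht', ofReal_integral_eq_lintegral_ofReal]
        · refine Integrable.of_bound (C := 1) ?_ (ae_of_all _ fun x => ?_)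
          · simp only [dotProduct]
            fun_prop
          · rw [Real.norm_of_nonneg (Real.exp_pos _).le, Real.exp_le_one_iff]
            have : 0 ≤ x ⬝ᵥ x := by simpa using dotProduct_star_self_nonneg x
            nlinarith
        · exact ae_of_all _ fun x => (Real.exp_pos _).le
    _ = _ := by
        obtain ⟨h1, h2⟩ := integral_Ioi_one_add_two_mul_rpow hk
        rw [← h2, ofReal_integral_eq_lintegral_ofReal h1]
        refine (ae_restrict_iff' measurableSet_Ioi).2 (ae_of_all _ fun t ht => ?_)
        have ht' : (0 : ℝ) < t := ht
        simp only [Pi.zero_apply]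
        positivity

/-! ### Null hyperplanes and orthogonal complements -/

theorem gaussianPi_dotProduct_ne_zero {κ : Type*} [Fintype κ] {w : κ → ℝ} (hw : w ≠ 0) :
    ∀ᵐ y ∂gaussianPi κ, w ⬝ᵥ y ≠ 0 := by
  have hpos : 0 < w ⬝ᵥ w := by simpa using (dotProduct_star_self_pos_iff (v := w)).2 hw
  set c : ℝ := (√(w ⬝ᵥ w))⁻¹ with hc
  have hc0 : c ≠ 0 := by positivity
  -- The normalised `w` as a one-row matrix: its image law is a Gaussian on the line, which has no
  -- atom at zero.
  let W : Matrix Unit κ ℝ := Matrix.of fun _ => c • w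
  have hWW : W * Wᵀ = 1 := by
    ext i j
    have : c * c * (w ⬝ᵥ w) = 1 := by
      rw [hc, ← mul_inv, Real.mul_self_sqrt hpos.le, inv_mul_cancel₀ hpos.ne']
    simp only [Matrix.mul_apply', W, Matrix.one_apply_eq, Subsingleton.elim i j]
    change (c • w) ⬝ᵥ (c • w) = 1
    rw [smul_dotProduct, dotProduct_smul, smul_eq_mul, smul_eq_mul, ← mul_assoc, this]
  have hmap := gaussianPi_map_mulVec W hWW
  have hm : Measurable (fun x : κ → ℝ => W *ᵥ x) :=
    (Continuous.matrix_mulVec continuous_const continuous_id).measurable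
  have hna : NullSingletonClass (gaussianReal 0 1) := nullSingletonClass_gaussianReal one_ne_zero
  have hae : ∀ᵐ x ∂gaussianPi Unit, x ≠ 0 := by
    rw [ae_iff]
    simp
  rw [← hmap] at hae
  refine (ae_of_ae_map hm.aemeasurable hae).mono fun y hy h0 => hy ?_
  funext i
  change (c • w) ⬝ᵥ y = 0
  rw [smul_dotProduct, h0, smul_zero]

/-- An orthonormal basis of the orthogonal complement of `V`, as the rows of a matrix. -/
theorem exists_matrix_orthogonal_complement {κ : Type*} [Fintype κ] (V : Submodule ℝ (κ → ℝ)) :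
    ∃ W : Matrix (Fin (Fintype.card κ - Module.finrank ℝ V)) κ ℝ, W * Wᵀ = 1 ∧
      (∀ v ∈ V, W *ᵥ v = 0) ∧
      ∀ u, (∀ v ∈ V, u ⬝ᵥ v = 0) → Wᵀ *ᵥ (W *ᵥ u) = u := by
  classical
  let e : (κ → ℝ) ≃ₗ[ℝ] EuclideanSpace ℝ κ := (WithLp.linearEquiv 2 ℝ (κ → ℝ)).symm
  let V' : Submodule ℝ (EuclideanSpace ℝ κ) := V.map e.toLinearMap
  have hdim : Module.finrank ℝ V'ᗮ = Fintype.card κ - Module.finrank ℝ V := by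
    have h1 := V'.finrank_add_finrank_orthogonal
    have h2 : Module.finrank ℝ V' = Module.finrank ℝ V := LinearEquiv.finrank_map_eq e V
    rw [finrank_euclideanSpace, h2] at h1
    omega
  let b := (stdOrthonormalBasis ℝ V'ᗮ).reindex (finCongr hdim)
  have hin : ∀ x y : EuclideanSpace ℝ κ, inner ℝ x y = x.ofLp ⬝ᵥ y.ofLp := by
    intro x y
    rw [EuclideanSpace.inner_eq_star_dotProduct, star_trivial, dotProduct_comm]
  refine ⟨Matrix.of fun i => (b i : EuclideanSpace ℝ κ).ofLp, ?_, ?_, ?_⟩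
  · ext i j
    rw [Matrix.mul_apply']
    change (b i : EuclideanSpace ℝ κ).ofLp ⬝ᵥ (b j : EuclideanSpace ℝ κ).ofLp = _
    rw [← hin, ← Submodule.coe_inner, Matrix.one_apply]
    exact orthonormal_iff_ite.1 b.orthonormal i j
  · intro v hv
    funext i
    change (b i : EuclideanSpace ℝ κ).ofLp ⬝ᵥ v = 0
    have h := (Submodule.mem_orthogonal' V' _).1 (b i).2 (e v) (Submodule.mem_map_of_mem hv)
    rw [hin] at h
    exact h
  · intro u hu
    have hu' : e u ∈ V'ᗮ := by
      rw [Submodule.mem_orthogonal']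
      rintro _ ⟨v, hv, rfl⟩
      rw [hin]
      exact hu v hv
    have h := congrArg (fun x : V'ᗮ => (x : EuclideanSpace ℝ κ).ofLp) (b.sum_repr ⟨e u, hu'⟩)
    funext k
    have h' := congrFun h k
    simp only [AddSubmonoidClass.coe_finsetSum, WithLp.ofLp_sum, Finset.sum_apply] at h'
    rw [show (e u).ofLp k = u k from rfl] at h'
    rw [← h', Matrix.mulVec, dotProduct]
    refine Finset.sum_congr rfl fun i _ => ?_
    rw [OrthonormalBasis.repr_apply_apply, Submodule.coe_inner, hin]
    change (b i : EuclideanSpace ℝ κ).ofLp k * ((b i : EuclideanSpace ℝ κ).ofLp ⬝ᵥ u) = _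
    rw [mul_comm]
    rfl

/-! ### The diagonal of an inverse Wishart matrix -/

section Wishart

variable {ι κ : Type*} [Fintype ι] [Fintype κ]

/-- A proper subspace lies in a hyperplane; a row of `W` is a nonzero normal vector to it. -/
theorem ae_notMem_gaussianPi {V : Submodule ℝ (κ → ℝ)}
    (hV : Module.finrank ℝ V < Fintype.card κ) : ∀ᵐ y ∂gaussianPi κ, y ∉ V := by
  obtain ⟨W, hW, hWV, -⟩ := exists_matrix_orthogonal_complement V
  let i : Fin (Fintype.card κ - Module.finrank ℝ V) := ⟨0, by omega⟩
  have hi : W i ≠ 0 := by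
    intro h0
    have h1 := congrFun (congrFun hW i) i
    rw [Matrix.mul_apply', h0, zero_dotProduct, Matrix.one_apply_eq] at h1
    exact zero_ne_one h1
  exact (gaussianPi_dotProduct_ne_zero hi).mono fun y hy hyV => hy (congrFun (hWV y hyV) i)

/-- Induction on the rows: a fresh Gaussian row almost surely avoids the span of the fewer than
`card κ` previous ones. -/
theorem ae_linearIndepOn_gaussianPi (s : Finset ι) (hs : s.card ≤ Fintype.card κ) :
    ∀ᵐ Y ∂(Measure.pi fun _ : ι => gaussianPi κ), LinearIndepOn ℝ Y (s : Set ι) := by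
  classical
  induction s using Finset.induction_on with
  | empty => simp
  | insert i s his ih =>
    rw [Finset.card_insert_of_notMem his] at hs
    have ih := ih (by omega)
    have hmp := measurePreserving_update (fun _ : ι => gaussianPi κ) i
    have hmeas : MeasurableSet {Y : ι → κ → ℝ | LinearIndepOn ℝ Y ((insert i s : Finset ι) : Set ι)} := by
      have h1 : IsOpen {Y : ((insert i s : Finset ι) : Set ι) → κ → ℝ | LinearIndependent ℝ Y} :=
        isOpen_setOfPred_linearIndependent
      have h2 : Continuous fun (Y : ι → κ → ℝ) (j : ((insert i s : Finset ι) : Set ι)) => Y j := by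
        fun_prop
      exact (h1.preimage h2).measurableSet
    rw [← hmp.map_eq, ae_map_iff hmp.aemeasurable hmeas]
    refine (Measure.ae_prod_iff_ae_ae (hmp.measurable hmeas)).2 ?_
    refine ih.mono fun Y hY => ?_
    have hV : Module.finrank ℝ (Submodule.span ℝ (Y '' s)) < Fintype.card κ := by
      have h1 := finrank_span_finset_le_card (R := ℝ) (s.image Y)
      rw [Finset.coe_image] at h1
      exact (h1.trans Finset.card_image_le).trans_lt (by omega)
    refine (ae_notMem_gaussianPi hV).mono fun y hy => ?_
    have heq : Set.EqOn (Function.update Y i y) Y s := by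
      intro j hj
      refine Function.update_of_ne ?_ _ _
      rintro rfl
      exact his hj
    change LinearIndepOn ℝ (Function.update Y i y) _
    rw [Finset.coe_insert, linearIndepOn_insert (fun h => his (Finset.mem_coe.1 h)), heq.image_eq,
      Function.update_self, linearIndepOn_congr heq]
    exact ⟨hY, hy⟩

theorem ae_linearIndependent_gaussianPi (h : Fintype.card ι ≤ Fintype.card κ) :
    ∀ᵐ Y ∂(Measure.pi fun _ : ι => gaussianPi κ), LinearIndependent ℝ Y := by
  refine (ae_linearIndepOn_gaussianPi Finset.univ h).mono fun Y hY => ?_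
  rwa [Finset.coe_univ, linearIndepOn_univ_iff] at hY

variable [DecidableEq ι]

theorem det_mul_transpose_ne_zero {Y : Matrix ι κ ℝ} (hY : LinearIndependent ℝ Y.row) :
    (Y * Yᵀ).det ≠ 0 := by
  have := Matrix.PosDef.mul_conjTranspose_self Y (Matrix.vecMul_injective_iff.2 hY)
  rw [conjTranspose_eq_transpose_of_trivial] at this
  exact this.det_pos.ne'

/-- A diagonal entry of the inverse Gram matrix is the inverse squared distance of the row
to the span of the other rows. -/
theorem inv_mul_transpose_apply_self {Y : Matrix ι κ ℝ} (hY : (Y * Yᵀ).det ≠ 0) (i : ι)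
    {k : Type*} [Fintype k] {W : Matrix k κ ℝ} (hW0 : ∀ j, j ≠ i → W *ᵥ Y j = 0)
    (hWu : ∀ u, (∀ j, j ≠ i → u ⬝ᵥ Y j = 0) → Wᵀ *ᵥ (W *ᵥ u) = u) :
    (Y * Yᵀ)⁻¹ i i = ((W *ᵥ Y i) ⬝ᵥ (W *ᵥ Y i))⁻¹ := by
  set L := (Y * Yᵀ)⁻¹ with hL
  have hLY : L * (Y * Yᵀ) = 1 := Matrix.nonsing_inv_mul _ (isUnit_iff_ne_zero.2 hY)
  -- The dual vector to row `i`: it pairs to one with `Y i` and to zero with the other rows, so it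
  -- lies in their orthogonal complement. Projecting `u = ∑ L i j • Y j` there leaves only the term
  -- `j = i`.
  set u : κ → ℝ := (L * Y) i with hu
  have huY : ∀ j, u ⬝ᵥ Y j = (1 : Matrix ι ι ℝ) i j := by
    intro j
    rw [← hLY, ← Matrix.mul_assoc]
    rfl
  have huW : Wᵀ *ᵥ (W *ᵥ u) = u := hWu u fun j hj => by
    rw [huY, Matrix.one_apply_ne hj.symm]
  have hWuL : W *ᵥ u = L i i • (W *ᵥ Y i) := by
    have h1 : u = ∑ j, L i j • Y j := by
      funext k
      simp [hu, Matrix.mul_apply]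
    rw [h1, Matrix.mulVec_sum, Finset.sum_eq_single i]
    · rw [Matrix.mulVec_smul]
    · intro j _ hj
      rw [Matrix.mulVec_smul, hW0 j hj, smul_zero]
    · simp
  have h1 : L i i * ((W *ᵥ Y i) ⬝ᵥ (W *ᵥ Y i)) = 1 := by
    rw [← smul_eq_mul, ← smul_dotProduct, ← hWuL, dotProduct_mulVec, ← Matrix.mulVec_transpose,
      huW, huY, Matrix.one_apply_eq]
  exact eq_inv_of_mul_eq_one_left h1

theorem measurable_inv_mul_transpose_apply (i j : ι) :
    Measurable fun Y : ι → κ → ℝ => ((Matrix.of Y) * (Matrix.of Y)ᵀ)⁻¹ i j := by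
  have hc : Continuous fun Y : ι → κ → ℝ => (Matrix.of Y) * (Matrix.of Y)ᵀ := by
    have h : Continuous fun Y : ι → κ → ℝ => Matrix.of Y := continuous_id
    exact h.matrix_mul h.matrix_transpose
  simp only [Matrix.inv_def, Matrix.smul_apply, Ring.inverse_eq_inv', smul_eq_mul]
  exact hc.matrix_det.measurable.inv.mul (hc.matrix_adjugate.matrix_elem i j).measurable

/-- Given the other rows, the entry is the inverse squared norm of the projection of row `i` onto
their complement, and that projection is again standard Gaussian. -/
theorem lintegral_inv_mul_transpose_apply_self (h : Fintype.card ι + 1 < Fintype.card κ) (i : ι) :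
    ∫⁻ Y, ENNReal.ofReal (((Matrix.of Y) * (Matrix.of Y)ᵀ)⁻¹ i i)
        ∂(Measure.pi fun _ : ι => gaussianPi κ)
      = ENNReal.ofReal (1 / ((Fintype.card κ : ℝ) - Fintype.card ι - 1)) := by
  have hmp := measurePreserving_update (fun _ : ι => gaussianPi κ) i
  have hm := (measurable_inv_mul_transpose_apply (κ := κ) i i).ennreal_ofReal
  have hli := ae_linearIndependent_gaussianPi (ι := ι) (κ := κ) (by omega)
  have hli2 : ∀ᵐ Y ∂(Measure.pi fun _ : ι => gaussianPi κ), ∀ᵐ y ∂gaussianPi κ,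
      LinearIndependent ℝ (Function.update Y i y) := by
    rw [← hmp.map_eq] at hli
    exact Measure.ae_ae_of_ae_prod (ae_of_ae_map hmp.aemeasurable hli)
  rw [← hmp.map_eq, lintegral_map hm hmp.measurable]
  refine (lintegral_prod _ (hm.comp hmp.measurable).aemeasurable).trans ?_
  have key : ∀ᵐ Y ∂(Measure.pi fun _ : ι => gaussianPi κ),
      ∫⁻ y, ENNReal.ofReal (((Matrix.of (Function.update Y i y)) *
        (Matrix.of (Function.update Y i y))ᵀ)⁻¹ i i) ∂gaussianPi κ
      = ENNReal.ofReal (1 / ((Fintype.card κ : ℝ) - Fintype.card ι - 1)) := by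
    filter_upwards [hli, hli2] with Y hY hY2
    set V : Submodule ℝ (κ → ℝ) := Submodule.span ℝ (Set.range fun j : {j // j ≠ i} => Y j) with hV
    have hdim : Module.finrank ℝ V = Fintype.card ι - 1 := by
      have hY' : LinearIndependent ℝ fun j : {j // j ≠ i} => Y j :=
        hY.comp _ Subtype.val_injective
      rw [hV, finrank_span_eq_card hY']
      simp
    obtain ⟨W, hW, hWV, hWu⟩ := exists_matrix_orthogonal_complement V
    have hpos : 0 < Fintype.card ι := Fintype.card_pos_iff.2 ⟨i⟩
    have hmW : Measurable (fun x : κ → ℝ => W *ᵥ x) :=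
      (Continuous.matrix_mulVec continuous_const continuous_id).measurable
    have h1 : ∀ᵐ y ∂gaussianPi κ, ENNReal.ofReal (((Matrix.of (Function.update Y i y)) *
        (Matrix.of (Function.update Y i y))ᵀ)⁻¹ i i)
        = ENNReal.ofReal ((W *ᵥ y) ⬝ᵥ (W *ᵥ y))⁻¹ := by
      filter_upwards [hY2] with y hy
      rw [inv_mul_transpose_apply_self (Y := Matrix.of (Function.update Y i y))
        (det_mul_transpose_ne_zero hy) i (W := W)]
      · change ENNReal.ofReal (((W *ᵥ Function.update Y i y i) ⬝ᵥ
          (W *ᵥ Function.update Y i y i))⁻¹) = _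
        rw [Function.update_self]
      · intro j hj
        change W *ᵥ Function.update Y i y j = 0
        rw [Function.update_of_ne hj]
        exact hWV _ (Submodule.subset_span ⟨⟨j, hj⟩, rfl⟩)
      · intro u hu
        refine hWu u fun v hv => ?_
        induction hv using Submodule.span_induction with
        | mem x hx =>
          obtain ⟨⟨j, hj⟩, rfl⟩ := hx
          have := hu j hj
          change u ⬝ᵥ Function.update Y i y j = 0 at this
          rwa [Function.update_of_ne hj] at this
        | zero => simp
        | add x y _ _ hx hy => rw [dotProduct_add, hx, hy, add_zero]
        | smul a x _ hx => rw [dotProduct_smul, hx, smul_zero]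
    have hm2 : Measurable fun x : Fin (Fintype.card κ - Module.finrank ℝ V) → ℝ =>
        ENNReal.ofReal (x ⬝ᵥ x)⁻¹ := by
      simp only [dotProduct]
      fun_prop
    -- The complement has dimension `k = card κ - (card ι - 1)`, so `k - 2 = card κ - card ι - 1`,
    -- and the hypothesis is precisely `2 < k`.
    rw [lintegral_congr_ae h1, ← lintegral_map hm2 hmW, gaussianPi_map_mulVec W hW,
      lintegral_inv_dotProduct_gaussianPi (by rw [Fintype.card_fin, hdim]; omega),
      Fintype.card_fin, hdim, Nat.cast_sub (by omega), Nat.cast_sub (by omega)]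
    congr 2
    push_cast
    ring
  refine (lintegral_congr_ae key).trans ?_
  rw [lintegral_const, measure_univ, mul_one]

theorem inv_mul_transpose_apply_self_nonneg (Y : Matrix ι κ ℝ) (i : ι) :
    0 ≤ (Y * Yᵀ)⁻¹ i i := by
  have := (Matrix.posSemidef_self_mul_conjTranspose Y).inv.diag_nonneg (i := i)
  rwa [conjTranspose_eq_transpose_of_trivial] at this

theorem integrable_inv_mul_transpose_apply_self (h : Fintype.card ι + 1 < Fintype.card κ) (i : ι) :
    Integrable (fun Y : ι → κ → ℝ => ((Matrix.of Y) * (Matrix.of Y)ᵀ)⁻¹ i i)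
      (Measure.pi fun _ : ι => gaussianPi κ) := by
  refine ⟨(measurable_inv_mul_transpose_apply i i).aestronglyMeasurable, ?_⟩
  rw [hasFiniteIntegral_iff_ofReal (ae_of_all _ fun Y => inv_mul_transpose_apply_self_nonneg _ i),
    lintegral_inv_mul_transpose_apply_self h]
  exact ENNReal.ofReal_lt_top

/-- The mean of the diagonal of the inverse Wishart distribution. -/
theorem integral_inv_mul_transpose_apply_self (h : Fintype.card ι + 1 < Fintype.card κ) (i : ι) :
    ∫ Y, ((Matrix.of Y) * (Matrix.of Y)ᵀ)⁻¹ i i ∂(Measure.pi fun _ : ι => gaussianPi κ)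
      = 1 / ((Fintype.card κ : ℝ) - Fintype.card ι - 1) := by
  rw [integral_eq_lintegral_of_nonneg_ae
    (ae_of_all _ fun Y => inv_mul_transpose_apply_self_nonneg _ i)
    (measurable_inv_mul_transpose_apply i i).aestronglyMeasurable,
    lintegral_inv_mul_transpose_apply_self h, ENNReal.toReal_ofReal]
  have : (Fintype.card ι : ℝ) + 1 < Fintype.card κ := by exact_mod_cast h
  exact one_div_nonneg.2 (by linarith)

end Wishart

/-! ### Reduced singular value decomposition and pseudoinverses -/

theorem IsMoorePenrose.pinv_eq {k l : ℕ} {A : Matrix (Fin k) (Fin l) ℝ}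
    {B : Matrix (Fin l) (Fin k) ℝ} (h : IsMoorePenrose A B) : pinv A = B :=
  (pinv_spec A).unique h

theorem frobSq_eq_trace {k l : ℕ} (A : Matrix (Fin k) (Fin l) ℝ) :
    frobSq A = (A * Aᵀ).trace := by
  simp [frobSq, Matrix.trace, Matrix.mul_apply, sq]

/-- A reduced singular value decomposition, with the left singular vectors scaled by the singular
values. -/
structure ReducedSVD {m n : ℕ} (H : Matrix (Fin m) (Fin n) ℝ) where
  W : Matrix (Fin H.rank) (Fin n) ℝ
  G : Matrix (Fin m) (Fin H.rank) ℝ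
  d : Fin H.rank → ℝ
  mul_transpose : W * Wᵀ = 1
  eq_mul : H = G * W
  gram : Gᵀ * G = diagonal d
  ne_zero : ∀ i, d i ≠ 0

/-- Diagonalise `Hᵀ * H` by `U`. The columns of `H * U` are orthogonal with squared norms the
eigenvalues, so those of eigenvalue zero vanish and can be dropped. Thus `d` holds the squared
singular values. -/
theorem nonempty_reducedSVD {m n : ℕ} (H : Matrix (Fin m) (Fin n) ℝ) :
    Nonempty (ReducedSVD H) := by
  have hS : (Hᵀ * H).IsHermitian := by
    simpa using isHermitian_conjTranspose_mul_self H
  have hcard : Fintype.card {i // hS.eigenvalues i ≠ 0} = H.rank := by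
    rw [← hS.rank_eq_card_non_zero_eigs, Matrix.rank_transpose_mul_self]
  have hsp := hS.spectral_theorem
  set U : Matrix (Fin n) (Fin n) ℝ := (hS.eigenvectorUnitary).1 with hU
  set d := hS.eigenvalues with hd
  have hUU : Uᵀ * U = 1 := by
    have := Unitary.coe_star_mul_self hS.eigenvectorUnitary
    simpa [star_eq_conjTranspose] using this
  have hUU' : U * Uᵀ = 1 := mul_eq_one_comm.1 hUU
  have hS' : Hᵀ * H = U * diagonal d * Uᵀ := by
    rw [hsp]
    simp [Unitary.conjStarAlgAut_apply, star_eq_conjTranspose, hU, hd]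
  have hD : (H * U)ᵀ * (H * U) = diagonal d := by
    calc (H * U)ᵀ * (H * U) = Uᵀ * (Hᵀ * H) * U := by
          simp only [Matrix.transpose_mul, Matrix.mul_assoc]
      _ = (Uᵀ * U) * diagonal d * (Uᵀ * U) := by rw [hS']; simp only [Matrix.mul_assoc]
      _ = diagonal d := by rw [hUU, Matrix.one_mul, Matrix.mul_one]
  let f : Fin H.rank ≃ {i // d i ≠ 0} := (Fintype.equivFinOfCardEq hcard).symm
  let e : Fin H.rank → Fin n := fun a => (f a).1
  have he : Function.Injective e := Subtype.val_injective.comp f.injective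
  have h0 : ∀ j, d j = 0 → ∀ i, (H * U) i j = 0 := by
    intro j hj i
    have h1 := congrFun (congrFun hD j) j
    rw [diagonal_apply_eq, hj, Matrix.mul_apply] at h1
    simp only [Matrix.transpose_apply] at h1
    have := (Finset.sum_eq_zero_iff_of_nonneg fun i _ => mul_self_nonneg _).1 h1 i
      (Finset.mem_univ i)
    exact mul_self_eq_zero.1 this
  refine ⟨⟨(Uᵀ).submatrix e id, (H * U).submatrix id e, d ∘ e, ?_, ?_, ?_, fun i => (f i).2⟩⟩
  · rw [Matrix.transpose_submatrix, Matrix.transpose_transpose,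
      ← Matrix.submatrix_mul _ _ _ _ _ Function.bijective_id, hUU, Matrix.submatrix_one _ he]
  · calc H = (H * U) * Uᵀ := by rw [Matrix.mul_assoc, hUU', Matrix.mul_one]
      _ = _ := by
        ext i k
        rw [Matrix.mul_apply, Matrix.mul_apply]
        simp only [Matrix.submatrix_apply, id_eq]
        rw [← Finset.sum_image (f := fun j => (H * U) i j * Uᵀ j k) (s := Finset.univ)
          (g := e) he.injOn]
        refine (Finset.sum_subset (Finset.subset_univ _) fun j _ hj => ?_).symm
        rw [h0 j, zero_mul]
        by_contra hne
        refine hj (Finset.mem_image.2 ⟨f.symm ⟨j, hne⟩, Finset.mem_univ _, ?_⟩)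
        simp [e]
  · rw [Matrix.transpose_submatrix, ← Matrix.submatrix_mul _ _ _ _ _ Function.bijective_id, hD,
      Matrix.submatrix_diagonal _ _ he]

namespace ReducedSVD

variable {m n T : ℕ} {H : Matrix (Fin m) (Fin n) ℝ} (D : ReducedSVD H)

theorem diagonal_mul_diagonal_inv : diagonal D.d * diagonal D.d⁻¹ = 1 := by
  rw [diagonal_mul_diagonal, ← diagonal_one]
  congr 1
  funext i
  exact mul_inv_cancel₀ (D.ne_zero i)

theorem diagonal_inv_mul_diagonal : diagonal D.d⁻¹ * diagonal D.d = 1 :=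
  mul_eq_one_comm.1 D.diagonal_mul_diagonal_inv

theorem pinv_eq : pinv H = D.Wᵀ * diagonal D.d⁻¹ * D.Gᵀ := by
  have h1 : D.W * D.Wᵀ = 1 := D.mul_transpose
  have h2 := D.gram
  have h4 := D.diagonal_inv_mul_diagonal
  have hAB : H * (D.Wᵀ * diagonal D.d⁻¹ * D.Gᵀ) = D.G * diagonal D.d⁻¹ * D.Gᵀ := by
    calc _ = D.G * D.W * (D.Wᵀ * diagonal D.d⁻¹ * D.Gᵀ) := congrArg (· * _) D.eq_mul
      _ = D.G * (D.W * D.Wᵀ) * diagonal D.d⁻¹ * D.Gᵀ := by simp only [Matrix.mul_assoc]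
      _ = _ := by rw [h1, Matrix.mul_one]
  have hBA : D.Wᵀ * diagonal D.d⁻¹ * D.Gᵀ * H = D.Wᵀ * D.W := by
    calc _ = D.Wᵀ * diagonal D.d⁻¹ * D.Gᵀ * (D.G * D.W) := congrArg (_ * ·) D.eq_mul
      _ = D.Wᵀ * (diagonal D.d⁻¹ * (D.Gᵀ * D.G)) * D.W := by simp only [Matrix.mul_assoc]
      _ = _ := by rw [h2, h4, Matrix.mul_one]
  refine IsMoorePenrose.pinv_eq ⟨?_, ?_, ?_, ?_⟩
  · rw [Matrix.mul_assoc, hBA]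
    conv_rhs => rw [D.eq_mul]
    conv_lhs => enter [1]; rw [D.eq_mul]
    calc _ = D.G * (D.W * D.Wᵀ) * D.W := by simp only [Matrix.mul_assoc]
      _ = _ := by rw [h1, Matrix.mul_one]
  · rw [hBA]
    calc _ = D.Wᵀ * (D.W * D.Wᵀ) * diagonal D.d⁻¹ * D.Gᵀ := by simp only [Matrix.mul_assoc]
      _ = _ := by rw [h1, Matrix.mul_one]
  · rw [hAB]; simp [Matrix.mul_assoc]
  · rw [hBA]; simp

theorem frobSq_pinv : frobSq (pinv H) = ∑ i, (D.d i)⁻¹ := by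
  rw [D.pinv_eq, frobSq_eq_trace]
  have : D.Wᵀ * diagonal D.d⁻¹ * D.Gᵀ * (D.Wᵀ * diagonal D.d⁻¹ * D.Gᵀ)ᵀ
      = D.Wᵀ * (diagonal D.d⁻¹ * D.W) := by
    calc _ = D.Wᵀ * (diagonal D.d⁻¹ * (D.Gᵀ * D.G)) * diagonal D.d⁻¹ * D.W := by
          simp only [Matrix.transpose_mul, Matrix.transpose_transpose, diagonal_transpose,
            Matrix.mul_assoc]
      _ = _ := by rw [D.gram, D.diagonal_inv_mul_diagonal, Matrix.mul_one, Matrix.mul_assoc]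
  rw [this, Matrix.trace_mul_comm, Matrix.mul_assoc, D.mul_transpose, Matrix.mul_one,
    Matrix.trace_diagonal]
  rfl

variable {X : Matrix (Fin n) (Fin T) ℝ}

/-- The pseudoinverse of the clean data matrix, for generic states. -/
theorem pinv_transpose_mul_eq (hX : ((D.W * X) * (D.W * X)ᵀ).det ≠ 0) :
    pinv (H * X)ᵀ
      = D.G * diagonal D.d⁻¹ * ((D.W * X) * (D.W * X)ᵀ)⁻¹ * (D.W * X) := by
  have h2 := D.gram
  have h4 := D.diagonal_inv_mul_diagonal
  set Y := D.W * X with hY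
  set L := (Y * Yᵀ)⁻¹ with hL
  have hLY : L * (Y * Yᵀ) = 1 := Matrix.nonsing_inv_mul _ (isUnit_iff_ne_zero.2 hX)
  have hYL : (Y * Yᵀ) * L = 1 := Matrix.mul_nonsing_inv _ (isUnit_iff_ne_zero.2 hX)
  have hLT : Lᵀ = L := by
    rw [hL, Matrix.transpose_nonsing_inv, Matrix.transpose_mul, Matrix.transpose_transpose]
  have hA : (H * X)ᵀ = Yᵀ * D.Gᵀ := by
    conv_lhs => rw [D.eq_mul, Matrix.mul_assoc, Matrix.transpose_mul]
  rw [hA]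
  have hGd : D.Gᵀ * (D.G * diagonal D.d⁻¹) = 1 := by
    rw [← Matrix.mul_assoc, h2, D.diagonal_mul_diagonal_inv]
  -- The two products are the orthogonal projections onto the row space of `Y` and the range of `G`,
  -- which yields the Penrose conditions.
  have hAB : Yᵀ * D.Gᵀ * (D.G * diagonal D.d⁻¹ * L * Y) = Yᵀ * L * Y := by
    calc _ = Yᵀ * (D.Gᵀ * (D.G * diagonal D.d⁻¹)) * L * Y := by simp only [Matrix.mul_assoc]
      _ = _ := by rw [hGd, Matrix.mul_one]
  have hBA : D.G * diagonal D.d⁻¹ * L * Y * (Yᵀ * D.Gᵀ) = D.G * diagonal D.d⁻¹ * D.Gᵀ := by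
    calc _ = D.G * diagonal D.d⁻¹ * (L * (Y * Yᵀ)) * D.Gᵀ := by simp only [Matrix.mul_assoc]
      _ = _ := by rw [hLY, Matrix.mul_one]
  refine IsMoorePenrose.pinv_eq ⟨?_, ?_, ?_, ?_⟩
  · rw [hAB]
    calc _ = Yᵀ * (L * (Y * Yᵀ)) * D.Gᵀ := by simp only [Matrix.mul_assoc]
      _ = _ := by rw [hLY, Matrix.mul_one]
  · rw [hBA]
    calc _ = D.G * diagonal D.d⁻¹ * (D.Gᵀ * (D.G * diagonal D.d⁻¹)) * L * Y := by
          simp only [Matrix.mul_assoc]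
      _ = _ := by rw [hGd, Matrix.mul_one]
  · rw [hAB]; simp [Matrix.mul_assoc, hLT]
  · rw [hBA]; simp [Matrix.mul_assoc]

theorem frobSq_pinv_transpose_mul (hX : ((D.W * X) * (D.W * X)ᵀ).det ≠ 0) :
    frobSq (pinv (H * X)ᵀ)
      = ∑ i, (D.d i)⁻¹ * ((D.W * X) * (D.W * X)ᵀ)⁻¹ i i := by
  rw [D.pinv_transpose_mul_eq hX, frobSq_eq_trace]
  set Y := D.W * X with hY
  set L := (Y * Yᵀ)⁻¹ with hL
  have hYL : (Y * Yᵀ) * L = 1 := Matrix.mul_nonsing_inv _ (isUnit_iff_ne_zero.2 hX)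
  have hLT : Lᵀ = L := by
    rw [hL, Matrix.transpose_nonsing_inv, Matrix.transpose_mul, Matrix.transpose_transpose]
  have h1 : D.G * diagonal D.d⁻¹ * L * Y * (D.G * diagonal D.d⁻¹ * L * Y)ᵀ
      = D.G * (diagonal D.d⁻¹ * L * diagonal D.d⁻¹ * D.Gᵀ) := by
    calc _ = D.G * diagonal D.d⁻¹ * L * ((Y * Yᵀ) * L) * diagonal D.d⁻¹ * D.Gᵀ := by
          simp only [Matrix.transpose_mul, hLT, diagonal_transpose, Matrix.mul_assoc]
      _ = _ := by rw [hYL, Matrix.mul_one]; simp only [Matrix.mul_assoc]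
  rw [h1, Matrix.trace_mul_comm, Matrix.mul_assoc, D.gram, Matrix.mul_assoc,
    D.diagonal_inv_mul_diagonal, Matrix.mul_one, Matrix.trace]
  simp [Matrix.diagonal_mul]

/-- Multiplying by `Hᵀ` cancels `G (diagonal d)⁻¹`, so the singular values disappear; this is why
the `σ²` term sees only the rank of `H`. -/
theorem frobSq_transpose_mul_pinv (hX : ((D.W * X) * (D.W * X)ᵀ).det ≠ 0) :
    frobSq (Hᵀ * pinv (H * X)ᵀ) = ∑ i, ((D.W * X) * (D.W * X)ᵀ)⁻¹ i i := by
  rw [D.pinv_transpose_mul_eq hX, frobSq_eq_trace]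
  have hHT : Hᵀ = D.Wᵀ * D.Gᵀ := by
    conv_lhs => rw [D.eq_mul, Matrix.transpose_mul]
  rw [hHT]
  set Y := D.W * X with hY
  set L := (Y * Yᵀ)⁻¹ with hL
  have hYL : (Y * Yᵀ) * L = 1 := Matrix.mul_nonsing_inv _ (isUnit_iff_ne_zero.2 hX)
  have hLT : Lᵀ = L := by
    rw [hL, Matrix.transpose_nonsing_inv, Matrix.transpose_mul, Matrix.transpose_transpose]
  have h0 : D.Wᵀ * D.Gᵀ * (D.G * diagonal D.d⁻¹ * L * Y) = D.Wᵀ * L * Y := by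
    calc _ = D.Wᵀ * ((D.Gᵀ * D.G) * diagonal D.d⁻¹) * L * Y := by simp only [Matrix.mul_assoc]
      _ = _ := by rw [D.gram, D.diagonal_mul_diagonal_inv, Matrix.mul_one]
  have h1 : D.Wᵀ * L * Y * (D.Wᵀ * L * Y)ᵀ = D.Wᵀ * (L * D.W) := by
    calc _ = D.Wᵀ * (L * ((Y * Yᵀ) * L)) * D.W := by
          simp only [Matrix.transpose_mul, hLT, Matrix.transpose_transpose, Matrix.mul_assoc]
      _ = _ := by rw [hYL, Matrix.mul_one]; simp only [Matrix.mul_assoc]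
  rw [h0, h1, Matrix.trace_mul_comm, Matrix.mul_assoc, D.mul_transpose, Matrix.mul_one]
  rfl

end ReducedSVD

/-- From `B = B A B` and the symmetry of `B A`, `B = Aᵀ Bᵀ B` has range inside that of `H`. No
genericity of `X` is needed. -/
theorem vecMul_pinv_transpose_mul {m n T : ℕ} {H : Matrix (Fin m) (Fin n) ℝ}
    (X : Matrix (Fin n) (Fin T) ℝ) {ν : Fin m → ℝ} (hν : Hᵀ *ᵥ ν = 0) :
    ν ᵥ* pinv (H * X)ᵀ = 0 := by
  rw [Matrix.mulVec_transpose] at hν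
  have h := pinv_spec (H * X)ᵀ
  set A := (H * X)ᵀ with hA
  rw [← h.mul_mul_right, ← h.symm_right, Matrix.transpose_mul, hA, Matrix.transpose_transpose,
    Matrix.mul_assoc, Matrix.mul_assoc, ← Matrix.vecMul_vecMul, hν,
    Matrix.zero_vecMul]

/-! ### Second moments of sums of independent terms -/

section SecondMoment

/-- Independence of the factors replaces the fourth moments that a general product would require. -/
theorem MeasureTheory.MemLp.two_mul_prod {α β : Type*} [MeasurableSpace α] [MeasurableSpace β]
    {μ : Measure α} {ρ : Measure β} [SFinite μ] [SFinite ρ] {f : α → ℝ} {g : β → ℝ}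
    (hf : MemLp f 2 μ) (hg : MemLp g 2 ρ) :
    MemLp (fun p : α × β => f p.1 * g p.2) 2 (μ.prod ρ) := by
  have hm : AEStronglyMeasurable (fun p : α × β => f p.1 * g p.2) (μ.prod ρ) :=
    hf.aestronglyMeasurable.comp_fst.mul hg.aestronglyMeasurable.comp_snd
  rw [memLp_two_iff_integrable_sq hm]
  simp only [mul_pow]
  exact hf.integrable_sq.mul_prod hg.integrable_sq

theorem memLp_sum_pi {ι : Type*} [Fintype ι] {Ω : ι → Type*} [∀ i, MeasurableSpace (Ω i)]
    {μ : ∀ i, Measure (Ω i)} [∀ i, IsProbabilityMeasure (μ i)] {f : ∀ i, Ω i → ℝ}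
    (hf : ∀ i, MemLp (f i) 2 (μ i)) : MemLp (fun x => ∑ i, f i (x i)) 2 (Measure.pi μ) :=
  memLp_finsetSum _ fun i _ => (hf i).comp_measurePreserving (measurePreserving_eval μ i)

theorem integral_sum_pi_eq_zero {ι : Type*} [Fintype ι] {Ω : ι → Type*}
    [∀ i, MeasurableSpace (Ω i)]
    {μ : ∀ i, Measure (Ω i)} [∀ i, IsProbabilityMeasure (μ i)] {f : ∀ i, Ω i → ℝ}
    (hf : ∀ i, MemLp (f i) 2 (μ i)) (h0 : ∀ i, ∫ x, f i x ∂μ i = 0) :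
    ∫ x, ∑ i, f i (x i) ∂Measure.pi μ = 0 := by
  rw [integral_finsetSum]
  · refine Finset.sum_eq_zero fun i _ => ?_
    rw [integral_comp_eval (hf i).aestronglyMeasurable, h0]
  · exact fun i _ => ((hf i).comp_measurePreserving (measurePreserving_eval μ i)).integrable
      one_le_two

theorem integral_sq_sum_pi {ι : Type*} [Fintype ι] {Ω : ι → Type*} [∀ i, MeasurableSpace (Ω i)]
    {μ : ∀ i, Measure (Ω i)} [∀ i, IsProbabilityMeasure (μ i)] {f : ∀ i, Ω i → ℝ}
    (hf : ∀ i, MemLp (f i) 2 (μ i)) (h0 : ∀ i, ∫ x, f i x ∂μ i = 0) :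
    ∫ x, (∑ i, f i (x i)) ^ 2 ∂Measure.pi μ = ∑ i, ∫ x, f i x ^ 2 ∂μ i := by
  have h := variance_sum_pi hf
  have he : (∑ i, fun ω : ∀ i, Ω i => f i (ω i)) = fun ω => ∑ i, f i (ω i) := by
    funext ω; simp
  rw [he, variance_of_integral_eq_zero (memLp_sum_pi hf).aestronglyMeasurable.aemeasurable
    (integral_sum_pi_eq_zero hf h0)] at h
  rw [h]
  exact Finset.sum_congr rfl fun i _ =>
    variance_of_integral_eq_zero (hf i).aestronglyMeasurable.aemeasurable (h0 i)

variable {κ : Type*} [Fintype κ] (v : NNReal)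

theorem memLp_dotProduct_pi_gaussianReal (a : κ → ℝ) :
    MemLp (fun x => a ⬝ᵥ x) 2 (Measure.pi fun _ : κ => gaussianReal 0 v) :=
  memLp_sum_pi (f := fun i x => a i * x) fun i =>
    (memLp_id_gaussianReal' 2 (by norm_num)).const_mul (a i)

theorem integral_dotProduct_pi_gaussianReal (a : κ → ℝ) :
    ∫ x, a ⬝ᵥ x ∂(Measure.pi fun _ : κ => gaussianReal 0 v) = 0 :=
  integral_sum_pi_eq_zero (f := fun i x => a i * x)
    (fun i => (memLp_id_gaussianReal' 2 (by norm_num)).const_mul (a i))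
    fun i => by rw [integral_const_mul, integral_id_gaussianReal, mul_zero]

theorem integral_sq_gaussianReal : ∫ x, x ^ 2 ∂gaussianReal 0 v = v := by
  have h := variance_fun_id_gaussianReal (μ := 0) (v := v)
  rwa [variance_of_integral_eq_zero (by fun_prop) integral_id_gaussianReal] at h

theorem integral_sq_dotProduct_pi_gaussianReal (a : κ → ℝ) :
    ∫ x, (a ⬝ᵥ x) ^ 2 ∂(Measure.pi fun _ : κ => gaussianReal 0 v) = v * (a ⬝ᵥ a) := by
  have h := integral_sq_sum_pi (μ := fun _ : κ => gaussianReal 0 v) (f := fun i x => a i * x)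
    (fun i => (memLp_id_gaussianReal' 2 (by norm_num)).const_mul (a i))
    fun i => by rw [integral_const_mul, integral_id_gaussianReal, mul_zero]
  refine h.trans ?_
  simp only [mul_pow, integral_const_mul, integral_sq_gaussianReal, dotProduct, Finset.mul_sum]
  exact Finset.sum_congr rfl fun i _ => by ring

end SecondMoment

/-! ### The residual at a fresh sample -/

section TestSample

variable {m n : ℕ} (H : Matrix (Fin m) (Fin n) ℝ) (σ : ℝ)

theorem meas_dotProduct (w : DCSample m n) (u : Fin m → ℝ) :
    meas H w ⬝ᵥ u = (Hᵀ *ᵥ u) ⬝ᵥ w.1 + u ⬝ᵥ w.2 := by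
  rw [meas, add_dotProduct, dotProduct_comm w.2, dotProduct_comm, dotProduct_mulVec,
    Matrix.mulVec_transpose]

theorem memLp_meas_dotProduct (u : Fin m → ℝ) :
    MemLp (fun w => meas H w ⬝ᵥ u) 2 (sampleLaw m n σ) := by
  simp only [meas_dotProduct]
  exact ((memLp_dotProduct_pi_gaussianReal 1 _).comp_fst _).add
    ((memLp_dotProduct_pi_gaussianReal _ u).comp_snd _)

/-- State and noise are independent and centred, so the cross term vanishes. -/
theorem integral_sq_meas_dotProduct (u : Fin m → ℝ) :
    ∫ w, (meas H w ⬝ᵥ u) ^ 2 ∂sampleLaw m n σ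
      = (Hᵀ *ᵥ u) ⬝ᵥ (Hᵀ *ᵥ u) + σ ^ 2 * (u ⬝ᵥ u) := by
  simp only [meas_dotProduct]
  set a := Hᵀ *ᵥ u
  have h1 := memLp_dotProduct_pi_gaussianReal 1 a
  have h2 := memLp_dotProduct_pi_gaussianReal (σ ^ 2).toNNReal u
  have e : ∀ w : DCSample m n, (a ⬝ᵥ w.1 + u ⬝ᵥ w.2) ^ 2
      = (a ⬝ᵥ w.1) ^ 2 + (u ⬝ᵥ w.2) ^ 2 + 2 * ((a ⬝ᵥ w.1) * (u ⬝ᵥ w.2)) := fun w => by ring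
  simp only [e, sampleLaw]
  have i1 : Integrable (fun w : DCSample m n => (a ⬝ᵥ w.1) ^ 2)
      ((Measure.pi fun _ : Fin n => gaussianReal 0 1).prod
        (Measure.pi fun _ : Fin m => gaussianReal 0 (σ ^ 2).toNNReal)) := h1.integrable_sq.comp_fst _
  have i2 : Integrable (fun w : DCSample m n => (u ⬝ᵥ w.2) ^ 2)
      ((Measure.pi fun _ : Fin n => gaussianReal 0 1).prod
        (Measure.pi fun _ : Fin m => gaussianReal 0 (σ ^ 2).toNNReal)) := h2.integrable_sq.comp_snd _
  have i3 : Integrable (fun w : DCSample m n => (a ⬝ᵥ w.1) * (u ⬝ᵥ w.2))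
      ((Measure.pi fun _ : Fin n => gaussianReal 0 1).prod
        (Measure.pi fun _ : Fin m => gaussianReal 0 (σ ^ 2).toNNReal)) :=
    (h1.integrable one_le_two).mul_prod (h2.integrable one_le_two)
  have i12 : Integrable (fun w : DCSample m n => (a ⬝ᵥ w.1) ^ 2 + (u ⬝ᵥ w.2) ^ 2)
      ((Measure.pi fun _ : Fin n => gaussianReal 0 1).prod
        (Measure.pi fun _ : Fin m => gaussianReal 0 (σ ^ 2).toNNReal)) := i1.add i2
  rw [integral_add i12 (i3.const_mul 2), integral_add i1 i2, integral_const_mul,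
    integral_prod_mul (fun x => a ⬝ᵥ x) (fun x => u ⬝ᵥ x),
    integral_fun_fst (fun x => (a ⬝ᵥ x) ^ 2), integral_fun_snd (fun x => (u ⬝ᵥ x) ^ 2),
    integral_dotProduct_pi_gaussianReal, integral_sq_dotProduct_pi_gaussianReal,
    integral_sq_dotProduct_pi_gaussianReal, Real.coe_toNNReal _ (sq_nonneg σ)]
  simp

end TestSample

/-! ### Noise with independent random coefficients -/

section Noise

/-- Second moment of a combination of noise terms whose coefficients are independent of the
noise. -/
theorem second_moment_noise_combination {Ω : Type*} [MeasurableSpace Ω] {μ : Measure Ω}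
    [IsProbabilityMeasure μ] {m T : ℕ} (v : NNReal) {ν : Fin m → ℝ} (hν : ν ⬝ᵥ ν = 1)
    {c : Ω → Fin T → ℝ} (hc : ∀ t, MemLp (fun x => c x t) 2 μ) :
    MemLp (fun p : Ω × (Fin T → Fin m → ℝ) => ∑ t, c p.1 t * (ν ⬝ᵥ p.2 t)) 2
      (μ.prod (Measure.pi fun _ => Measure.pi fun _ => gaussianReal 0 v)) ∧
    ∫ p : Ω × (Fin T → Fin m → ℝ), (∑ t, c p.1 t * (ν ⬝ᵥ p.2 t)) ^ 2
      ∂(μ.prod (Measure.pi fun _ => Measure.pi fun _ => gaussianReal 0 v))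
      = v * ∑ t, ∫ x, c x t ^ 2 ∂μ := by
  set Q : Measure (Fin m → ℝ) := Measure.pi fun _ => gaussianReal 0 v with hQ
  have hη : MemLp (fun ε => ν ⬝ᵥ ε) 2 Q := memLp_dotProduct_pi_gaussianReal v ν
  have hηt : ∀ t, MemLp (fun ε : Fin T → Fin m → ℝ => ν ⬝ᵥ ε t) 2 (Measure.pi fun _ => Q) :=
    fun t => hη.comp_measurePreserving (measurePreserving_eval (fun _ : Fin T => Q) t)
  have hM : MemLp (fun p : Ω × (Fin T → Fin m → ℝ) => ∑ t, c p.1 t * (ν ⬝ᵥ p.2 t)) 2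
      (μ.prod (Measure.pi fun _ => Q)) :=
    memLp_finsetSum _ fun t _ => (hc t).two_mul_prod (hηt t)
  refine ⟨hM, ?_⟩
  -- For fixed coefficients the noise terms are independent and centred, so only squares survive.
  rw [integral_prod _ hM.integrable_sq]
  have h : ∀ x, ∫ ε : Fin T → Fin m → ℝ, (∑ t, c x t * (ν ⬝ᵥ ε t)) ^ 2 ∂(Measure.pi fun _ => Q)
      = ∑ t, v * c x t ^ 2 := by
    intro x
    rw [integral_sq_sum_pi (μ := fun _ : Fin T => Q) (f := fun t ε => c x t * (ν ⬝ᵥ ε))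
      (fun t => hη.const_mul _)
      fun t => by rw [integral_const_mul, integral_dotProduct_pi_gaussianReal, mul_zero]]
    refine Finset.sum_congr rfl fun t _ => ?_
    simp only [mul_pow]
    rw [integral_const_mul, integral_sq_dotProduct_pi_gaussianReal, hν]
    ring
  simp only [h]
  rw [integral_finsetSum _ fun t _ => (hc t).integrable_sq.const_mul _, Finset.mul_sum]
  simp only [integral_const_mul]

end Noise

/-! ### Moments of the pseudoinverse of the clean data -/

section States

variable {m n T : ℕ} {H : Matrix (Fin m) (Fin n) ℝ}

/-- The state matrix of a family of states. -/
def stateCols (x : Fin T → Fin n → ℝ) : Matrix (Fin n) (Fin T) ℝ := Matrix.of fun i t => x t i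

theorem measurePreserving_mul_stateCols {r : ℕ} {W : Matrix (Fin r) (Fin n) ℝ}
    (hW : W * Wᵀ = 1) :
    MeasurePreserving (fun (x : Fin T → Fin n → ℝ) (a : Fin r) (t : Fin T) => (W *ᵥ x t) a)
      (Measure.pi fun _ => gaussianPi (Fin n)) (Measure.pi fun _ => gaussianPi (Fin T)) := by
  have hmW : Measurable (fun x : Fin n → ℝ => W *ᵥ x) :=
    (Continuous.matrix_mulVec continuous_const continuous_id).measurable
  have h1 : MeasurePreserving (fun (x : Fin T → Fin n → ℝ) t => W *ᵥ x t)
      (Measure.pi fun _ => gaussianPi (Fin n)) (Measure.pi fun _ => gaussianPi (Fin r)) :=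
    measurePreserving_pi _ _ fun _ => ⟨hmW, gaussianPi_map_mulVec W hW⟩
  have h2 : MeasurePreserving (fun (x : Fin T → Fin r → ℝ) (a : Fin r) (t : Fin T) => x t a)
      (Measure.pi fun _ => gaussianPi (Fin r)) (Measure.pi fun _ => gaussianPi (Fin T)) :=
    ⟨by fun_prop, pi_pi_map_swap _⟩
  exact h2.comp h1

/-- Almost surely both Frobenius norms are linear in the diagonal of `L`, so integrability and means
come from the inverse Wishart diagonal. -/
theorem second_moment_pinv_stateCols (hrank : H.rank + 1 < T) :
    (∀ i t, MemLp (fun x : Fin T → Fin n → ℝ => pinv (H * stateCols x)ᵀ i t) 2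
      (Measure.pi fun _ => gaussianPi (Fin n))) ∧
    (∀ j t, MemLp (fun x : Fin T → Fin n → ℝ => (Hᵀ * pinv (H * stateCols x)ᵀ) j t) 2
      (Measure.pi fun _ => gaussianPi (Fin n))) ∧
    ∑ i, ∑ t, ∫ x : Fin T → Fin n → ℝ, pinv (H * stateCols x)ᵀ i t ^ 2
      ∂(Measure.pi fun _ => gaussianPi (Fin n)) = frobSq (pinv H) / ((T : ℝ) - H.rank - 1) ∧
    ∑ j, ∑ t, ∫ x : Fin T → Fin n → ℝ, (Hᵀ * pinv (H * stateCols x)ᵀ) j t ^ 2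
      ∂(Measure.pi fun _ => gaussianPi (Fin n)) = H.rank / ((T : ℝ) - H.rank - 1) := by
  obtain ⟨D⟩ := nonempty_reducedSVD H
  set μ : Measure (Fin T → Fin n → ℝ) := Measure.pi fun _ => gaussianPi (Fin n) with hμ
  have hmp := measurePreserving_mul_stateCols (T := T) D.mul_transpose
  have hcard : Fintype.card (Fin H.rank) + 1 < Fintype.card (Fin T) := by simpa using hrank
  let Y : (Fin T → Fin n → ℝ) → Matrix (Fin H.rank) (Fin T) ℝ := fun x => D.W * stateCols x
  let L : (Fin T → Fin n → ℝ) → Matrix (Fin H.rank) (Fin H.rank) ℝ := fun x => (Y x * (Y x)ᵀ)⁻¹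
  have hdet : ∀ᵐ x ∂μ, (Y x * (Y x)ᵀ).det ≠ 0 :=
    (hmp.quasiMeasurePreserving.ae (ae_linearIndependent_gaussianPi (by omega))).mono
      fun x hx => det_mul_transpose_ne_zero hx
  have hLm : ∀ i j, Measurable fun x => L x i j := fun i j =>
    (measurable_inv_mul_transpose_apply i j).comp hmp.measurable
  have hYm : ∀ i t, Measurable fun x => Y x i t := fun i t =>
    (measurable_pi_apply t).comp ((measurable_pi_apply i).comp hmp.measurable)
  have hLi : ∀ i, Integrable (fun x => L x i i) μ := fun i =>
    hmp.integrable_comp_of_integrable (integrable_inv_mul_transpose_apply_self hcard i)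
  have hLint : ∀ i, ∫ x, L x i i ∂μ = 1 / ((T : ℝ) - H.rank - 1) := by
    intro i
    have h := integral_inv_mul_transpose_apply_self hcard i
    rw [← hmp.map_eq, integral_map hmp.aemeasurable
      (measurable_inv_mul_transpose_apply i i).aestronglyMeasurable] at h
    simp only [Fintype.card_fin] at h
    exact h
  -- The pseudoinverse is defined by choice; measurability comes from its explicit formula, valid
  -- almost everywhere.
  have hBm : ∀ i t, AEStronglyMeasurable (fun x => pinv (H * stateCols x)ᵀ i t) μ := by
    intro i t
    have h : Measurable fun x =>
        ∑ j, (∑ k, (D.G * diagonal D.d⁻¹) i k * L x k j) * Y x j t :=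
      Finset.measurable_sum _ fun j _ =>
        (Finset.measurable_sum _ fun k _ => (hLm k j).const_mul _).mul (hYm j t)
    refine h.aestronglyMeasurable.congr (hdet.mono fun x hx => ?_)
    simp only
    rw [D.pinv_transpose_mul_eq hx, Matrix.mul_apply]
    exact Finset.sum_congr rfl fun j _ => by rw [Matrix.mul_apply]
  have hB1 : ∀ᵐ x ∂μ, ∑ i, (D.d i)⁻¹ * L x i i = frobSq (pinv (H * stateCols x)ᵀ) :=
    hdet.mono fun x hx => (D.frobSq_pinv_transpose_mul hx).symm
  have hB2 : ∀ᵐ x ∂μ, ∑ i, L x i i = frobSq (Hᵀ * pinv (H * stateCols x)ᵀ) :=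
    hdet.mono fun x hx => (D.frobSq_transpose_mul_pinv hx).symm
  have hFi : Integrable (fun x => frobSq (pinv (H * stateCols x)ᵀ)) μ :=
    (integrable_finsetSum _ fun i _ => (hLi i).const_mul _).congr hB1
  have hB : ∀ i t, MemLp (fun x => pinv (H * stateCols x)ᵀ i t) 2 μ := by
    intro i t
    rw [memLp_two_iff_integrable_sq (hBm i t)]
    refine hFi.mono' ((hBm i t).pow 2) (ae_of_all _ fun x => ?_)
    rw [Real.norm_of_nonneg (sq_nonneg _), frobSq]
    refine le_trans ?_ (Finset.single_le_sum (f := fun i => ∑ j, pinv (H * stateCols x)ᵀ i j ^ 2)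
      (fun i _ => Finset.sum_nonneg fun j _ => sq_nonneg _) (Finset.mem_univ i))
    exact Finset.single_le_sum (f := fun j => pinv (H * stateCols x)ᵀ i j ^ 2)
      (fun j _ => sq_nonneg _) (Finset.mem_univ t)
  have hC : ∀ j t, MemLp (fun x => (Hᵀ * pinv (H * stateCols x)ᵀ) j t) 2 μ :=
    fun j t => memLp_finsetSum Finset.univ fun i _ => (hB i t).const_mul (Hᵀ j i)
  have hsum : ∀ {k : ℕ} (F : (Fin T → Fin n → ℝ) → Matrix (Fin k) (Fin T) ℝ),
      (∀ i t, MemLp (fun x => F x i t) 2 μ) →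
      ∑ i, ∑ t, ∫ x, F x i t ^ 2 ∂μ = ∫ x, frobSq (F x) ∂μ := by
    intro k F hF
    simp only [frobSq]
    rw [integral_finsetSum _ fun i _ => integrable_finsetSum _ fun t _ => (hF i t).integrable_sq]
    refine Finset.sum_congr rfl fun i _ => ?_
    rw [integral_finsetSum _ fun t _ => (hF i t).integrable_sq]
  refine ⟨hB, hC, ?_, ?_⟩
  · rw [hsum _ hB, ← integral_congr_ae hB1, integral_finsetSum _ fun i _ => (hLi i).const_mul _,
      D.frobSq_pinv, Finset.sum_div]
    refine Finset.sum_congr rfl fun i _ => ?_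
    rw [integral_const_mul, hLint, mul_one_div]
  · rw [hsum _ hC, ← integral_congr_ae hB2, integral_finsetSum _ fun i _ => hLi i]
    simp only [hLint]
    simp [div_eq_mul_inv]

end States

/-! ### The training expectation and its exact value -/

section Training

variable {m n T : ℕ} {H : Matrix (Fin m) (Fin n) ℝ} {ν : Fin m → ℝ}

instance (m n T : ℕ) (σ : ℝ) : IsProbabilityMeasure (trainLaw m n T σ) := by
  unfold trainLaw; infer_instance

theorem measurePreserving_trainLaw (m n T : ℕ) (σ : ℝ) :
    MeasurePreserving (MeasurableEquiv.arrowProdEquivProdArrow (Fin n → ℝ) (Fin m → ℝ) (Fin T))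
      (trainLaw m n T σ)
      ((Measure.pi fun _ => gaussianPi (Fin n)).prod
        (Measure.pi fun _ => Measure.pi fun _ => gaussianReal 0 (σ ^ 2).toNNReal)) :=
  measurePreserving_arrowProdEquivProdArrow _ _ _ _ _

theorem second_moment_trainLaw (σ : ℝ) (hν : ν ⬝ᵥ ν = 1)
    {c : (Fin T → Fin n → ℝ) → Fin T → ℝ}
    (hc : ∀ t, MemLp (fun x => c x t) 2 (Measure.pi fun _ => gaussianPi (Fin n))) :
    MemLp (fun s : Fin T → DCSample m n => ∑ t, c (fun t => (s t).1) t * (ν ⬝ᵥ (s t).2)) 2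
      (trainLaw m n T σ) ∧
    ∫ s : Fin T → DCSample m n, (∑ t, c (fun t => (s t).1) t * (ν ⬝ᵥ (s t).2)) ^ 2
      ∂trainLaw m n T σ
      = σ ^ 2 * ∑ t, ∫ x, c x t ^ 2 ∂(Measure.pi fun _ => gaussianPi (Fin n)) := by
  have hmp := measurePreserving_trainLaw m n T σ
  obtain ⟨h1, h2⟩ := second_moment_noise_combination (σ ^ 2).toNNReal hν hc
  refine ⟨h1.comp_measurePreserving hmp, ?_⟩
  rw [Real.coe_toNNReal _ (sq_nonneg σ)] at h2
  rw [← h2]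
  exact hmp.integral_comp' (fun p : (Fin T → Fin n → ℝ) × (Fin T → Fin m → ℝ) =>
    (∑ t, c p.1 t * (ν ⬝ᵥ p.2 t)) ^ 2)

theorem mulVec_noise_apply {k : ℕ} (C : Matrix (Fin k) (Fin T) ℝ) (s : Fin T → DCSample m n)
    (i : Fin k) : (C *ᵥ ((noiseMatrix s)ᵀ *ᵥ ν)) i = ∑ t, C i t * (ν ⬝ᵥ (s t).2) := by
  rw [Matrix.mulVec, dotProduct]
  refine Finset.sum_congr rfl fun t _ => ?_
  rw [dotProduct_comm ν]
  rfl

theorem firstOrderError_apply (s : Fin T → DCSample m n) (i : Fin m) :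
    firstOrderError H ν s i
      = -∑ t, pinv (H * stateCols fun t => (s t).1)ᵀ i t * (ν ⬝ᵥ (s t).2) := by
  rw [firstOrderError, Pi.neg_apply, mulVec_noise_apply]
  rfl

theorem transpose_mulVec_nullEstimator_apply (hnull : Hᵀ *ᵥ ν = 0) (s : Fin T → DCSample m n)
    (j : Fin n) :
    (Hᵀ *ᵥ nullEstimator H ν s) j
      = -∑ t, (Hᵀ * pinv (H * stateCols fun t => (s t).1)ᵀ) j t * (ν ⬝ᵥ (s t).2) := by
  rw [nullEstimator, Matrix.mulVec_add, hnull, zero_add, firstOrderError, Matrix.mulVec_neg,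
    Matrix.mulVec_mulVec, Pi.neg_apply, mulVec_noise_apply]
  rfl

theorem nullEstimator_dotProduct_self (hnull : Hᵀ *ᵥ ν = 0) (hunit : ν ⬝ᵥ ν = 1)
    (s : Fin T → DCSample m n) :
    nullEstimator H ν s ⬝ᵥ nullEstimator H ν s = 1 + ∑ i, firstOrderError H ν s i ^ 2 := by
  have h : ν ⬝ᵥ firstOrderError H ν s = 0 := by
    rw [firstOrderError, dotProduct_neg, dotProduct_mulVec, cleanMatrix,
      vecMul_pinv_transpose_mul _ hnull, zero_dotProduct, neg_zero]
  rw [nullEstimator, add_dotProduct, dotProduct_add, dotProduct_add, hunit, h,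
    dotProduct_comm (firstOrderError H ν s) ν, h, add_zero, zero_add, dotProduct]
  simp [sq]

theorem memLp_nullEstimator (hrank : H.rank + 1 < T) (hunit : ν ⬝ᵥ ν = 1) (σ : ℝ) (i : Fin m) :
    MemLp (fun s => nullEstimator H ν s i) 2 (trainLaw m n T σ) := by
  have h := (second_moment_trainLaw σ hunit ((second_moment_pinv_stateCols hrank).1 i)).1.neg
  refine (memLp_const (ν i)).add (h.ae_eq (ae_of_all _ fun s => ?_))
  exact (firstOrderError_apply s i).symm

/-- `|Hᵀδ|²` and the unit vector `ν` give the `σ²` terms; `σ²|δ|²` gives the `σ⁴` term, since `|δ|²`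
already has mean of order `σ²`. -/
theorem genError_eq (hrank : H.rank + 1 < T) (hnull : Hᵀ *ᵥ ν = 0) (hunit : ν ⬝ᵥ ν = 1)
    (σ : ℝ) :
    genError H ν T σ = σ ^ 2 * (1 + H.rank / ((T : ℝ) - H.rank - 1))
      + σ ^ 4 * (frobSq (pinv H) / ((T : ℝ) - H.rank - 1)) := by
  obtain ⟨hB, hC, hB1, hB2⟩ := second_moment_pinv_stateCols hrank
  have h1 := fun i => second_moment_trainLaw σ hunit (hB i)
  have h2 := fun j => second_moment_trainLaw σ hunit (hC j)
  have hpt : ∀ s : Fin T → DCSample m n, ∫ w, testResidual H ν s w ∂sampleLaw m n σ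
      = ∑ j, (∑ t, (Hᵀ * pinv (H * stateCols fun t => (s t).1)ᵀ) j t * (ν ⬝ᵥ (s t).2)) ^ 2
        + σ ^ 2 * (1 + ∑ i, (∑ t, pinv (H * stateCols fun t => (s t).1)ᵀ i t *
          (ν ⬝ᵥ (s t).2)) ^ 2) := by
    intro s
    simp only [testResidual]
    rw [integral_sq_meas_dotProduct, nullEstimator_dotProduct_self hnull hunit, dotProduct]
    simp only [firstOrderError_apply, transpose_mulVec_nullEstimator_apply hnull, neg_mul_neg,
      neg_sq]
    simp only [sq]
  simp only [genError, hpt]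
  have i1 := integrable_finsetSum Finset.univ fun i _ => (h1 i).1.integrable_sq
  have i2 := integrable_finsetSum Finset.univ fun j _ => (h2 j).1.integrable_sq
  have i3 : Integrable (fun s : Fin T → DCSample m n => σ ^ 2 * (1 + ∑ i,
      (∑ t, pinv (H * stateCols fun t => (s t).1)ᵀ i t * (ν ⬝ᵥ (s t).2)) ^ 2))
      (trainLaw m n T σ) := ((integrable_const 1).add i1).const_mul _
  rw [integral_add i2 i3, integral_const_mul,
    integral_add (integrable_const 1) i1,
    integral_finsetSum _ fun i _ => (h1 i).1.integrable_sq,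
    integral_finsetSum _ fun j _ => (h2 j).1.integrable_sq]
  simp only [fun i => (h1 i).2, fun j => (h2 j).2]
  rw [← Finset.mul_sum, ← Finset.mul_sum, hB1, hB2]
  simp only [integral_const, probReal_univ, smul_eq_mul]
  ring

theorem integrable_testResidual (hrank : H.rank + 1 < T) (hunit : ν ⬝ᵥ ν = 1) (σ : ℝ) :
    Integrable (fun p : (Fin T → DCSample m n) × DCSample m n => testResidual H ν p.1 p.2)
      ((trainLaw m n T σ).prod (sampleLaw m n σ)) := by
  have hz : ∀ i, MemLp (fun w => meas H w i) 2 (sampleLaw m n σ) := by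
    intro i
    simpa using memLp_meas_dotProduct H σ (Pi.single i 1)
  have h : MemLp (fun p : (Fin T → DCSample m n) × DCSample m n =>
      ∑ i, nullEstimator H ν p.1 i * meas H p.2 i) 2
      ((trainLaw m n T σ).prod (sampleLaw m n σ)) :=
    memLp_finsetSum _ fun i _ => (memLp_nullEstimator hrank hunit σ i).two_mul_prod (hz i)
  refine h.integrable_sq.congr (ae_of_all _ fun p => ?_)
  simp only [testResidual, dotProduct, mul_comm]

/-! ### Large test sets and the law of large numbers -/

theorem testSetResidual_eq_sum (s : Fin T → DCSample m n) (w : ℕ → DCSample m n) (N : ℕ) :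
    testSetResidual H ν s w N = ∑ t ∈ Finset.range N, testResidual H ν s (w t) := by
  rw [← Fin.sum_univ_eq_sum_range (fun t => testResidual H ν s (w t))]
  simp only [testSetResidual, testResidual, sq]
  rfl

theorem integrable_testResidual_left (hrank : H.rank + 1 < T) (hunit : ν ⬝ᵥ ν = 1) (σ : ℝ)
    (w : DCSample m n) : Integrable (fun s => testResidual H ν s w) (trainLaw m n T σ) := by
  have h : MemLp (fun s => ∑ i, meas H w i * nullEstimator H ν s i) 2 (trainLaw m n T σ) :=
    memLp_finsetSum _ fun i _ => (memLp_nullEstimator hrank hunit σ i).const_mul _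
  exact h.integrable_sq

/-- The integral is a quadratic form in the measurement, with the second moments of the estimator as
coefficients. It is thus measurable everywhere, although the estimator is only known to be so almost
everywhere. -/
theorem measurable_integral_testResidual (hrank : H.rank + 1 < T) (hunit : ν ⬝ᵥ ν = 1) (σ : ℝ) :
    Measurable fun w => ∫ s, testResidual H ν s w ∂trainLaw m n T σ := by
  have hM := memLp_nullEstimator (H := H) (n := n) hrank hunit σ
  have h : ∀ w, ∫ s, testResidual H ν s w ∂trainLaw m n T σ = ∑ i, ∑ j, meas H w i * meas H w j *
      ∫ s, nullEstimator H ν s i * nullEstimator H ν s j ∂trainLaw m n T σ := by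
    intro w
    have e : ∀ s : Fin T → DCSample m n, testResidual H ν s w = ∑ i, ∑ j,
        meas H w i * meas H w j * (nullEstimator H ν s i * nullEstimator H ν s j) := by
      intro s
      rw [testResidual, sq, dotProduct, Finset.sum_mul_sum]
      exact Finset.sum_congr rfl fun i _ => Finset.sum_congr rfl fun j _ => by ring
    have hi : ∀ i j, Integrable (fun s => meas H w i * meas H w j *
        (nullEstimator H ν s i * nullEstimator H ν s j)) (trainLaw m n T σ) :=
      fun i j => ((hM i).integrable_mul (hM j)).const_mul _
    simp only [e]
    rw [integral_finsetSum _ fun i _ => integrable_finsetSum _ fun j _ => hi i j]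
    refine Finset.sum_congr rfl fun i _ => ?_
    rw [integral_finsetSum _ fun j _ => hi i j]
    simp only [integral_const_mul]
  have hz : ∀ i, Measurable fun w : DCSample m n => meas H w i := by
    intro i
    simp only [meas, Pi.add_apply, Matrix.mulVec, dotProduct]
    fun_prop
  simp only [h]
  exact Finset.measurable_sum _ fun i _ => Finset.measurable_sum _ fun j _ =>
    ((hz i).mul (hz j)).mul_const _

/-- After exchanging the training expectation with the finite sum, the quotient is an empirical mean
of `f` over independent samples; by Fubini the mean of `f` is the generalization error. -/
theorem ae_tendsto_integral_testSetResidual (hrank : H.rank + 1 < T) (hunit : ν ⬝ᵥ ν = 1)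
    (σ : ℝ) :
    ∀ᵐ w ∂testLaw m n σ, Tendsto
      (fun N : ℕ => (∫ s, testSetResidual H ν s w N ∂trainLaw m n T σ) / (N : ℝ))
      atTop (𝓝 (genError H ν T σ)) := by
  obtain ⟨f, hf⟩ : ∃ f : DCSample m n → ℝ,
    f = fun w => ∫ s, testResidual H ν s w ∂trainLaw m n T σ := ⟨_, rfl⟩
  have hfm : Measurable f := hf ▸ measurable_integral_testResidual hrank hunit σ
  have hint := integrable_testResidual (H := H) (n := n) hrank hunit σ
  have hfi : Integrable f (sampleLaw m n σ) := hf ▸ hint.integral_prod_right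
  have hev : ∀ t : ℕ, MeasurePreserving (fun w : ℕ → DCSample m n => w t) (testLaw m n σ)
      (sampleLaw m n σ) := fun t => measurePreserving_eval_infinitePi _ t
  have hind : iIndepFun (fun (t : ℕ) (w : ℕ → DCSample m n) => f (w t)) (testLaw m n σ) :=
    iIndepFun_infinitePi (X := fun _ => f) fun _ => hfm
  have hmean : ∫ w : ℕ → DCSample m n, f (w 0) ∂testLaw m n σ = genError H ν T σ := by
    rw [← integral_map (φ := fun w : ℕ → DCSample m n => w 0) (hev 0).aemeasurable
      hfm.aestronglyMeasurable, (hev 0).map_eq, hf]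
    exact (integral_integral_swap hint).symm
  have hid : ∀ t : ℕ, IdentDistrib (fun w : ℕ → DCSample m n => w t) (fun w => w 0)
      (testLaw m n σ) (testLaw m n σ) := fun t =>
    ⟨(hev t).aemeasurable, (hev 0).aemeasurable, (hev t).map_eq.trans (hev 0).map_eq.symm⟩
  have hlaw := strong_law_ae_real (fun (t : ℕ) (w : ℕ → DCSample m n) => f (w t))
    ((hev 0).integrable_comp_of_integrable hfi) (fun i j hij => hind.indepFun hij)
    (fun i => (hid i).comp hfm)
  rw [hmean] at hlaw
  refine hlaw.mono fun w hw => hw.congr fun N => ?_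
  simp only [testSetResidual_eq_sum, hf]
  rw [integral_finsetSum _ fun t _ => integrable_testResidual_left hrank hunit σ (w t)]

end Training

/-! ### The main theorem -/

theorem mainTheorem1 {m n T : ℕ} (H : Matrix (Fin m) (Fin n) ℝ) (hrank : H.rank + 1 = n)
    (hT : n < T) (ν : Fin m → ℝ) (hnull : Hᵀ *ᵥ ν = 0) (hunit : ν ⬝ᵥ ν = 1) :
    (∀ σ : ℝ,
      -- the double expectation is a genuine one
      Integrable (fun p : (Fin T → DCSample m n) × DCSample m n => testResidual H ν p.1 p.2)
        ((trainLaw m n T σ).prod (sampleLaw m n σ)) ∧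
      -- it is the almost sure limit of the training expectation of the average test residual
      (∀ᵐ w ∂testLaw m n σ,
        (∀ N : ℕ, Integrable (fun s => testSetResidual H ν s w N) (trainLaw m n T σ)) ∧
        Tendsto (fun N : ℕ => (∫ s, testSetResidual H ν s w N ∂trainLaw m n T σ) / (N : ℝ))
          atTop (𝓝 (genError H ν T σ))) ∧
      -- the closed form, with a remainder of fourth order in `σ` that is bounded explicitly
      |genError H ν T σ - σ ^ 2 * (1 + (H.rank : ℝ) / ((T : ℝ) - (n : ℝ)))|
        ≤ σ ^ 4 * (frobSq (pinv H) / ((T : ℝ) - (n : ℝ)))) ∧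
    (fun σ : ℝ => genError H ν T σ - σ ^ 2 * (1 + (H.rank : ℝ) / ((T : ℝ) - (n : ℝ))))
      =O[𝓝 0] (fun σ : ℝ => σ ^ 4) := by
  have hr : H.rank + 1 < T := by omega
  -- Rank `n - 1` turns the Wishart denominator `T - rank - 1` into `T - n`.
  have hn : (T : ℝ) - H.rank - 1 = (T : ℝ) - n := by
    rw [sub_sub]
    exact_mod_cast congrArg (fun k : ℕ => (T : ℝ) - k) hrank
  have hgen : ∀ σ, genError H ν T σ - σ ^ 2 * (1 + (H.rank : ℝ) / ((T : ℝ) - (n : ℝ)))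
      = σ ^ 4 * (frobSq (pinv H) / ((T : ℝ) - (n : ℝ))) := by
    intro σ
    rw [genError_eq hr hnull hunit, hn, add_sub_cancel_left]
  have hnonneg : 0 ≤ frobSq (pinv H) / ((T : ℝ) - (n : ℝ)) := by
    have h1 : (n : ℝ) < T := by exact_mod_cast hT
    exact div_nonneg (Finset.sum_nonneg fun i _ => Finset.sum_nonneg fun j _ => sq_nonneg _)
      (by linarith)
  refine ⟨fun σ => ⟨integrable_testResidual hr hunit σ, ?_, ?_⟩, ?_⟩
  · filter_upwards [ae_tendsto_integral_testSetResidual hr hunit σ] with w hw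
    refine ⟨fun N => ?_, hw⟩
    simp only [testSetResidual_eq_sum]
    exact integrable_finsetSum _ fun t _ => integrable_testResidual_left hr hunit σ (w t)
  · rw [hgen, abs_of_nonneg (mul_nonneg (by positivity) hnonneg)]
  · simp only [hgen, mul_comm _ (frobSq (pinv H) / _)]
    exact (isBigO_refl _ _).const_mul_left _
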